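/- **Setting.** Let $E,F,H$ be the generators of $\mathfrak g=\mathfrak{sl}(2,\mathbb R)$ with $[H,E]=2E$, $[H,F]=-2F$, $[E,F]=H$, let $\beta$ be the Killing form and $o=\tfrac18H$, so that $\Omega(X,Y)=\beta(o,[X,Y])$ satisfies $\Omega(E,F)=1$. Identify $\mathbb R^2$ with $\mathbb RE\oplus\mathbb RF$ by $(l,l')\mapsto lE+l'F$, and put $$\lambda_X(l,l')=\beta\big(\mathrm{Ad}(\exp(lE)\exp(l'F))\,o,\;X\big)\qquad(X\in\mathfrak g).$$ For real $\nu\neq0$ let $$u\star_\nu v=\sum_{k\ge0}\frac{\nu^k}{k!}\,\Lambda^{i_1j_1}\cdots\Lambda^{i_kj_k}\,(\partial_{i_1}\cdots\partial_{i_k}u)(\partial_{j_1}\cdots\partial_{j_k}v)$$ be the Weyl–Moyal product on $\mathbb R^2$, where $\Lambda$ is the Poisson tensor with $\{l,l'\}=1$, and let $$\mathrm{ad}_{\star_\nu}(X)u=\frac1{2\nu}(\lambda_X\star_\nu u-u\star_\nu\lambda_X),$$ where only finitely many terms are nonzero because $\lambda_X$ is a polynomial. For $\mu\in\mathbb C$,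 $\ell\in\mathbb Z$ let the principal series of $SL(2,\mathbb C)$ be given, on functions on $\mathbb C$, by $$\mathcal P^{\mu,\ell}(g)f(z)=|cz+d|^{\mu}\Big(\frac{cz+d}{|cz+d|}\Big)^{\ell}f\Big(\frac{az+b}{cz+d}\Big),\qquad g^{-1}=\begin{pmatrix}a&b\\c&d\end{pmatrix}.$$ **Theorem 4.2.** Let $\nu\in\mathbb R\setminus\{0\}$ be such that $\ell=1/\nu$ is an integer. 1. The star representation integrates to the group: there is a unique strongly continuous unitary representation $\pi$ of $SL(2,\mathbb R)$ on $L^2(\mathbb R^2)$ with $d\pi=\mathrm{ad}_{\star_\nu}$ on the Schwartz space, i.e. for all $X\in\mathfrak g$ and all Schwartz functions $u$ on $\mathbb R^2$, the function $\mathrm{ad}_{\star_\nu}(X)u$ is a Schwartz function and $$\frac{d}{dt}\Big|_{t=0}\pi(\exp tX)u=\mathrm{ad}_{\star_\nu}(X)u\quad\text{in }L^2(\mathbb R^2).$$ 2. The operators $\mathcal P^{-2,\ell}(g)$ define a strongly continuous unitary representation of $SL(2,\mathbb C)$ on $L^2(\mathbb C)$, and $\pi$ is equivalent to its restriction to $SL(2,\mathbb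 R)$. The intertwining operator is the partial Fourier transform in $l'$: the map $$(Tu)(l+i\nu\eta)=\int_{\mathbb R}e^{-i\Omega(\eta E,\,l'F)}\,u(l,l')\,dl'\qquad(u\text{ a Schwartz function})$$ extends to an isomorphism of topological vector spaces $T:L^2(\mathbb R^2)\to L^2(\mathbb C)$ with $$T\,\pi(g)=\mathcal P^{-2,\ell}(g)\,T\qquad\text{for all }g\in SL(2,\mathbb R).$$ -/

import Mathlib

open MeasureTheory Matrix
open scoped SchwartzMap MatrixGroups

noncomputable section

namespace StarRep

/-! ### The Lie algebra `sl(2, ℝ)` and the base point of the orbit -/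

/-- The Lie algebra `sl(2, ℝ)` of traceless real `2 × 2` matrices. -/
abbrev sl2 : Type := LieAlgebra.SpecialLinear.sl (Fin 2) ℝ

lemma mem_sl2 (A : Matrix (Fin 2) (Fin 2) ℝ) (h : A.trace = 0) :
    A ∈ LieAlgebra.SpecialLinear.sl (Fin 2) ℝ := LinearMap.mem_ker.2 h

lemma trace_sl2 (X : sl2) : (X : Matrix (Fin 2) (Fin 2) ℝ).trace = 0 := LinearMap.mem_ker.1 X.2

/-- The generators, with `[H, E] = 2E`, `[H, F] = -2F`, `[E, F] = H`. -/
def E : sl2 := ⟨!![0, 1; 0, 0], mem_sl2 _ (by simp [Matrix.trace_fin_two])⟩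

/-- See `E`. -/
def F : sl2 := ⟨!![0, 0; 1, 0], mem_sl2 _ (by simp [Matrix.trace_fin_two])⟩

/-- See `E`. -/
def H : sl2 := ⟨!![1, 0; 0, -1], mem_sl2 _ (by simp [Matrix.trace_fin_two])⟩

/-- The Killing form of `sl(2, ℝ)`. -/
def β (X Y : sl2) : ℝ := killingForm ℝ sl2 X Y

/-- The base point `o` of the adjoint orbit, a generator of the centre of the stabilizer `ℝ H`.
It is normalized by `β(o, [E, F]) = 1` (the Killing form has `β(H, H) = 8`), i.e. so that `(E, F)` is
a symplectic basis of `𝔮 = ℝ E ⊕ ℝ F`. -/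
def o : sl2 := (1 / 8 : ℝ) • H

/-- The (Kirillov-Kostant-Souriau) symplectic form `Ω(X, Y) = β(o, [X, Y])` on `𝔮`. -/
def Ω (X Y : sl2) : ℝ := β o ⁅X, Y⁆

/-! ### Exponential map and adjoint action -/

lemma det_exp_sl2 (X : sl2) : (NormedSpace.exp (X : Matrix (Fin 2) (Fin 2) ℝ)).det = 1 := by
  obtain ⟨A, hA⟩ : ∃ A : Matrix (Fin 2) (Fin 2) ℝ, A = X := ⟨_, rfl⟩
  rw [← hA]
  have htr : A 0 0 + A 1 1 = 0 := by
    have := trace_sl2 X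
    rwa [← hA, Matrix.trace_fin_two] at this
  let J : Matrix (Fin 2) (Fin 2) ℝ := !![0, 1; -1, 0]
  let J' : Matrix (Fin 2) (Fin 2) ℝ := !![0, -1; 1, 0]
  have hJJ : J * J' = 1 := by
    ext i j; fin_cases i <;> fin_cases j <;> simp [J, J', Matrix.mul_apply]
  have hinv : J⁻¹ = J' := Matrix.inv_eq_right_inv hJJ
  have hU : IsUnit J := ⟨⟨J, J', hJJ, mul_eq_one_comm.1 hJJ⟩, rfl⟩
  have hadj : ∀ B : Matrix (Fin 2) (Fin 2) ℝ, J * Bᵀ * J⁻¹ = B.adjugate := by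
    intro B
    rw [hinv, Matrix.adjugate_fin_two]
    ext i j; fin_cases i <;> fin_cases j <;>
      simp [J, J', Matrix.mul_apply, Matrix.vecMul, dotProduct, Fin.sum_univ_two]
  have hneg : J * Aᵀ * J⁻¹ = -A := by
    rw [hadj, Matrix.adjugate_fin_two]
    ext i j; fin_cases i <;> fin_cases j <;> simp <;> linarith
  have h1 : (NormedSpace.exp A).adjugate = NormedSpace.exp (-A) := by
    rw [← hadj, ← Matrix.exp_transpose, ← Matrix.exp_conj J _ hU, hneg]
  have h2 := Matrix.mul_adjugate (NormedSpace.exp A)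
  rw [h1, ← Matrix.exp_add_of_commute A (-A) (Commute.neg_right (Commute.refl A)), add_neg_cancel,
    NormedSpace.exp_zero] at h2
  have := congrFun (congrFun h2 0) 0
  simpa using this.symm

/-- The exponential map `sl(2, ℝ) → SL(2, ℝ)`. -/
def expSL (X : sl2) : SL(2, ℝ) :=
  ⟨NormedSpace.exp (X : Matrix (Fin 2) (Fin 2) ℝ), det_exp_sl2 X⟩

/-- The adjoint action `Ad(g) X = g X g⁻¹` of `SL(2, ℝ)` on its Lie algebra. -/
def Ad (g : SL(2, ℝ)) (X : sl2) : sl2 :=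
  ⟨(g : Matrix (Fin 2) (Fin 2) ℝ) * X * ((g⁻¹ : SL(2, ℝ)) : Matrix (Fin 2) (Fin 2) ℝ),
    mem_sl2 _ (by
      rw [Matrix.trace_mul_comm, ← mul_assoc, ← Matrix.SpecialLinearGroup.coe_mul,
        inv_mul_cancel, Matrix.SpecialLinearGroup.coe_one, one_mul]
      exact trace_sl2 X)⟩

/-! ### The Darboux chart, the moment map, the Moyal product and the star representation

The plane `𝔮 = 𝔩 ⊕ 𝔩'`, `𝔩 = ℝ E`, `𝔩' = ℝ F`, is identified with `ℝ × ℝ` by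
`(l, l') ↦ l E + l' F`; its symplectic form is then `dl ∧ dl'`. -/

/-- The Darboux chart `φ(l, l') = Ad(exp(l E) exp(l' F)) o` of the adjoint orbit of `o`. -/
def chart (x : ℝ × ℝ) : sl2 := Ad (expSL (x.1 • E) * expSL (x.2 • F)) o

/-- The moment map `λ_X = β(φ(·), X)`, as a complex valued function on the plane. -/
def moment (X : sl2) (x : ℝ × ℝ) : ℂ := ((β (chart x) X : ℝ) : ℂ)

/-- The partial derivatives `∂₀ = ∂/∂l` and `∂₁ = ∂/∂l'`. -/
def pd (i : Fin 2) (u : ℝ × ℝ → ℂ) (x : ℝ × ℝ) : ℂ :=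
  fderiv ℝ u x (![((1 : ℝ), (0 : ℝ)), ((0 : ℝ), (1 : ℝ))] i)

/-- The Poisson tensor of the plane: `{u, v} = ∑ Λ^{ij} ∂ᵢu ∂ⱼv`, with `{l, l'} = 1`. -/
def Λ : Matrix (Fin 2) (Fin 2) ℝ := !![0, 1; -1, 0]

/-- The bidifferential operators
`∑ Λ^{i₁j₁} ⋯ Λ^{iₖjₖ} (∂_{i₁} ⋯ ∂_{iₖ} u) (∂_{j₁} ⋯ ∂_{jₖ} v)`
of the Moyal product, the sum over the `2k` indices being written recursively. -/
def bidiff : ℕ → (ℝ × ℝ → ℂ) → (ℝ × ℝ → ℂ) → ℝ × ℝ → ℂ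
  | 0, u, v, x => u x * v x
  | k + 1, u, v, x => ∑ i : Fin 2, ∑ j : Fin 2, (Λ i j : ℂ) * bidiff k (pd i u) (pd j v) x

/-- The Weyl-Moyal product `u ⋆_ν v = ∑ₖ (ν^k / k!) ∑ Λ ⋯ Λ (∂⋯∂u) (∂⋯∂v)` at a real value of the
parameter. It is only used when one factor is a function `λ_X`; these are polynomials of degree
at most `3`, so that only the terms with `k ≤ 3` are nonzero. -/
def moyal (ν : ℝ) (u v : ℝ × ℝ → ℂ) (x : ℝ × ℝ) : ℂ :=
  ∑' k : ℕ, ((ν : ℂ) ^ k / (k.factorial : ℂ)) * bidiff k u v x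

/-- The infinitesimal star representation `ad_{⋆ν}(X) u = (λ_X ⋆_ν u - u ⋆_ν λ_X) / (2ν)`. -/
def adStar (ν : ℝ) (X : sl2) (u : ℝ × ℝ → ℂ) (x : ℝ × ℝ) : ℂ :=
  (1 / (2 * (ν : ℂ))) * (moyal ν (moment X) u x - moyal ν u (moment X) x)

/-! ### Hilbert spaces and representations -/

/-- The Hilbert space `L²(𝔮) = L²(ℝ²)`. -/
abbrev L2Plane : Type := Lp ℂ 2 (volume : Measure (ℝ × ℝ))

/-- The Hilbert space `L²(ℂ)`, with respect to Lebesgue measure. -/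
abbrev L2C : Type := Lp ℂ 2 (volume : Measure ℂ)

/-- Strong continuity of a unitary representation. -/
def StronglyContinuous {G V : Type*} [Group G] [TopologicalSpace G] [NormedAddCommGroup V]
    [NormedSpace ℂ V] (π : G →* (V ≃ₗᵢ[ℂ] V)) : Prop :=
  ∀ v : V, Continuous fun g => π g v

/-- A representation `π` of `SL(2, ℝ)` on `L²(ℝ²)` integrates `ad_{⋆ν}`, i.e. `dπ = ad_{⋆ν}`: for each
`X ∈ sl(2, ℝ)` and each Schwartz function `u`, the function `ad_{⋆ν}(X) u` is again a Schwartz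
function and it is the derivative at `t = 0`, in `L²(ℝ²)`, of `π(exp(tX)) u`. -/
def IntegratesAdStar (ν : ℝ) (π : SL(2, ℝ) →* (L2Plane ≃ₗᵢ[ℂ] L2Plane)) : Prop :=
  ∀ (X : sl2) (u : 𝓢(ℝ × ℝ, ℂ)), ∃ v : 𝓢(ℝ × ℝ, ℂ), (∀ x, v x = adStar ν X u x) ∧
    HasDerivAt (fun t : ℝ => π (expSL (t • X)) (u.toLp 2 volume)) (v.toLp 2 volume) 0

/-- The principal series operators
`(𝒫^{μ,ℓ}(g) f)(z) = |cz+d|^μ ((cz+d)/|cz+d|)^ℓ f((az+b)/(cz+d))`, where `g⁻¹ = (a b; c d)`,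
on functions on the complex plane; the formula is meaningful off the zero of `cz + d`. -/
def principalSeries (μ : ℂ) (ℓ : ℤ) (g : SL(2, ℂ)) (f : ℂ → ℂ) (z : ℂ) : ℂ :=
  let a : ℂ := (g⁻¹ : SL(2, ℂ)) 0 0
  let b : ℂ := (g⁻¹ : SL(2, ℂ)) 0 1
  let c : ℂ := (g⁻¹ : SL(2, ℂ)) 1 0
  let d : ℂ := (g⁻¹ : SL(2, ℂ)) 1 1
  (‖c * z + d‖ : ℂ) ^ μ * ((c * z + d) / (‖c * z + d‖ : ℂ)) ^ ℓ * f ((a * z + b) / (c * z + d))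

/-- `P` is the principal series representation `𝒫^{μ,ℓ}` of `SL(2, ℂ)`, realized by unitary
operators of `L²(ℂ)`. -/
def IsPrincipalSeries (μ : ℂ) (ℓ : ℤ) (P : SL(2, ℂ) →* (L2C ≃ₗᵢ[ℂ] L2C)) : Prop :=
  ∀ (g : SL(2, ℂ)) (f : L2C), P g f =ᵐ[volume] principalSeries μ ℓ g f

/-- The inclusion of `SL(2, ℝ)` in `SL(2, ℂ)`. -/
def inclSL : SL(2, ℝ) →* SL(2, ℂ) := Matrix.SpecialLinearGroup.map (algebraMap ℝ ℂ)

/-- The partial Fourier transform in the second variable,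
`û(l, η) = ∫ e^{-i Ω(η, l')} u(l, l') dl'`, where `η` stands for `η E` and `l'` for `l' F`. -/
def partialFourier (u : ℝ × ℝ → ℂ) (y : ℝ × ℝ) : ℂ :=
  ∫ l' : ℝ, Complex.exp (-Complex.I * (Ω (y.2 • E) (l' • F) : ℂ)) * u (y.1, l')

/-- `T : L²(ℝ²) → L²(ℂ)` is the partial Fourier transform followed by the identification
`(l, η) ↦ z = l + iνη` of the plane with `ℂ`; as `T` is continuous it is determined by its values on
Schwartz functions. -/
def IsPartialFourier (ν : ℝ) (T : L2Plane ≃L[ℂ] L2C) : Prop :=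
  ∀ u : 𝓢(ℝ × ℝ, ℂ),
    T (u.toLp 2 volume) =ᵐ[volume] fun z : ℂ => partialFourier u (z.re, z.im / ν)

end StarRep

end

/-! The function $\lambda_X$ is a polynomial of degree at most three whose only nonconstant
dependence on $l'$ is affine. The antisymmetrized Moyal product keeps only the odd orders one and
three, and the third-order term is a multiple of $\partial_l\partial_{l'}^2$ (`adStar_eq`). A
Fourier transform in $l'$ turns both $l'\partial_{l'}$ and $\partial_l\partial_{l'}^2$ into
operators of first order. In the variable $z=l+i\nu\eta$ the result is the vector field of the
Möbius action of $\mathfrak{sl}(2,\mathbb R)$ plus a multiplier, and for $\ell\nu=1$ this is exactly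
the derivative of $\mathcal P^{-2,\ell}$ (`psDeriv_fourierSnd`).

So $\pi$ is obtained by transport. The principal series is built as a unitary group of weighted
composition operators (`isIsometricWeight_moeb`, `psRep`), shown strongly continuous
(`stronglyContinuous_psRep`), and conjugated by the partial Fourier transform normalized to be
unitary (`starRep`). That its $L^2$ derivative on transforms of Schwartz functions is the pointwise
one follows by integrating along the one-parameter group and using strong continuity
(`hasDerivAt_psRep`).

Uniqueness rests on a core: smooth functions with compact support in $\mathbb C\setminus\mathbb R$.
It is dense (`dense_coreL2`), invariant under $SL(2,\mathbb R)$ because real Möbius maps have no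
pole off the real axis (`IsCore.principalSeries`), and consists of transforms of Schwartz functions
(`exists_normFourier_eq`). On such vectors $s\mapsto\pi'(\exp sX)^{-1}\pi(\exp sX)u$ has derivative
zero (`IntegratesAdStar.apply_eq`), so two integrated representations agree on the subgroups
$\exp\mathbb RE$ and $\exp\mathbb RF$, which generate the group (`sl2_generators`). -/

noncomputable section

namespace StarRep

/-! ### Explicit coordinates on $\mathfrak{sl}(2,\mathbb R)$, the chart, and unipotent generators -/

lemma sl2_apply_one_one (X : sl2) : X.1 1 1 = -X.1 0 0 := by
  have := trace_sl2 X
  rw [Matrix.trace_fin_two] at this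
  linarith

/-- The coordinates of an element of `sl(2, ℝ)` as a linear equivalence. -/
def sl2Coord : sl2 ≃ₗ[ℝ] (Fin 3 → ℝ) where
  toFun X := ![X.1 0 0, X.1 0 1, X.1 1 0]
  map_add' X Y := by ext i; fin_cases i <;> simp
  map_smul' c X := by ext i; fin_cases i <;> simp
  invFun v := ⟨!![v 0, v 1; v 2, -v 0], mem_sl2 _ (by simp [Matrix.trace_fin_two])⟩
  left_inv X := by
    ext i j
    fin_cases i <;> fin_cases j <;> simp [sl2_apply_one_one]
  right_inv v := by ext i; fin_cases i <;> simp

lemma killing_sl2 (X Y : sl2) : β X Y = 4 * (X.1 * Y.1).trace := by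
  rw [β, killingForm_apply_apply,
    LinearMap.trace_eq_matrix_trace ℝ (Module.Basis.ofEquivFun sl2Coord), Matrix.trace_fin_two,
    Matrix.trace, Fin.sum_univ_three]
  simp only [Matrix.diag_apply, LinearMap.toMatrix_apply, Module.Basis.ofEquivFun_repr_apply,
    Module.Basis.coe_ofEquivFun, LinearMap.comp_apply, LieAlgebra.ad_apply]
  simp [sl2Coord, Matrix.mul_apply, Fin.sum_univ_two, LieRing.of_associative_ring_bracket,
    sl2_apply_one_one, Matrix.vecMul, dotProduct]
  ring

lemma exp_of_sq_eq_zero (A : Matrix (Fin 2) (Fin 2) ℝ) (hA : A * A = 0) :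
    NormedSpace.exp A = 1 + A := by
  rw [NormedSpace.exp_eq_tsum ℝ]
  beta_reduce
  rw [tsum_eq_sum (s := Finset.range 2) fun n hn => ?_]
  · simp [Finset.sum_range_succ]
  · obtain ⟨m, rfl⟩ := Nat.exists_eq_add_of_le (not_lt.1 (Finset.mem_range.not.1 hn))
    rw [pow_add, sq, hA, zero_mul, smul_zero]

lemma coe_expSL_E (t : ℝ) : (expSL (t • E)).1 = !![1, t; 0, 1] := by
  have : ((t • E : sl2) : Matrix (Fin 2) (Fin 2) ℝ) = !![0, t; 0, 0] := by
    ext i j; fin_cases i <;> fin_cases j <;> simp [E]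
  change NormedSpace.exp ((t • E : sl2) : Matrix (Fin 2) (Fin 2) ℝ) = _
  rw [this, exp_of_sq_eq_zero _ (by ext i j; fin_cases i <;> fin_cases j <;> simp)]
  ext i j; fin_cases i <;> fin_cases j <;> simp

lemma coe_expSL_F (t : ℝ) : (expSL (t • F)).1 = !![1, 0; t, 1] := by
  have : ((t • F : sl2) : Matrix (Fin 2) (Fin 2) ℝ) = !![0, 0; t, 0] := by
    ext i j; fin_cases i <;> fin_cases j <;> simp [F]
  change NormedSpace.exp ((t • F : sl2) : Matrix (Fin 2) (Fin 2) ℝ) = _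
  rw [this, exp_of_sq_eq_zero _ (by ext i j; fin_cases i <;> fin_cases j <;> simp)]
  ext i j; fin_cases i <;> fin_cases j <;> simp

lemma β_chart (x : ℝ × ℝ) (X : sl2) :
    β (chart x) X = X.1 0 0 * (1 + 2 * x.1 * x.2) + X.1 0 1 * x.2
      - X.1 1 0 * (x.1 + x.1 ^ 2 * x.2) := by
  rw [killing_sl2, chart, Ad, Matrix.trace_fin_two]
  have h : (expSL (x.1 • E) * expSL (x.2 • F)).1 = !![1 + x.1 * x.2, x.1; x.2, 1] := by
    rw [Matrix.SpecialLinearGroup.coe_mul, show (expSL (x.1 • E) :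
      Matrix (Fin 2) (Fin 2) ℝ) = _ from coe_expSL_E _, show (expSL (x.2 • F) :
      Matrix (Fin 2) (Fin 2) ℝ) = _ from coe_expSL_F _]
    ext i j; fin_cases i <;> fin_cases j <;> simp
  simp only [Matrix.SpecialLinearGroup.coe_inv, h, Matrix.adjugate_fin_two]
  simp [Matrix.mul_apply, Fin.sum_univ_two, o, H, sl2_apply_one_one]
  ring

lemma Ω_smul_E_smul_F (a b : ℝ) : Ω (a • E) (b • F) = a * b := by
  rw [Ω, killing_sl2, Matrix.trace_fin_two]
  simp [Matrix.mul_apply, Fin.sum_univ_two, o, H, E, F, LieRing.of_associative_ring_bracket]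
  ring

/-- A matrix with nonzero lower left entry factors as upper times lower times upper unipotent. If
that entry vanishes, the upper left one does not, and multiplying by $\exp F$ on the left moves it
into the lower left corner. -/
lemma sl2_generators {K : Subgroup SL(2, ℝ)} (hE : ∀ t : ℝ, expSL (t • E) ∈ K)
    (hF : ∀ t : ℝ, expSL (t • F) ∈ K) : K = ⊤ := by
  have key : ∀ g : SL(2, ℝ), g.1 1 0 ≠ 0 → g ∈ K := by
    intro g hg
    have hd := g.det_coe
    rw [Matrix.det_fin_two] at hd
    have : g = expSL (((g.1 0 0 - 1) / g.1 1 0) • E) * expSL ((g.1 1 0) • F)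
        * expSL (((g.1 1 1 - 1) / g.1 1 0) • E) := by
      ext i j
      rw [Matrix.SpecialLinearGroup.coe_mul, Matrix.SpecialLinearGroup.coe_mul]
      rw [show (expSL (((g.1 0 0 - 1) / g.1 1 0) • E) : Matrix (Fin 2) (Fin 2) ℝ) = _ from
        coe_expSL_E _, show (expSL (((g.1 1 1 - 1) / g.1 1 0) • E) : Matrix (Fin 2) (Fin 2) ℝ) = _
        from coe_expSL_E _, show (expSL ((g.1 1 0) • F) : Matrix (Fin 2) (Fin 2) ℝ) = _ from
        coe_expSL_F _]
      fin_cases i <;> fin_cases j <;> simp [Matrix.mul_apply, Fin.sum_univ_two] <;> field_simp <;>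
        linarith
    rw [this]
    exact K.mul_mem (K.mul_mem (hE _) (hF _)) (hE _)
  refine eq_top_iff.2 fun g _ => ?_
  by_cases hg : g.1 1 0 = 0
  · have hd := g.det_coe
    rw [Matrix.det_fin_two, hg] at hd
    have h1 : expSL ((1 : ℝ) • F) * g ∈ K := by
      apply key
      rw [Matrix.SpecialLinearGroup.coe_mul, show (expSL ((1 : ℝ) • F) :
        Matrix (Fin 2) (Fin 2) ℝ) = _ from coe_expSL_F _]
      simp only [Matrix.mul_apply, Fin.sum_univ_two]
      simp [hg]
      rintro h
      simp [h] at hd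
    exact (K.mul_mem_cancel_left (hF 1)).1 h1
  · exact key g hg

/-! ### The star representation in coordinates -/

/-- A polynomial of the shape of the functions `λ_X` and their partial derivatives. -/
def cubic (a b c d e f : ℂ) (x : ℝ × ℝ) : ℂ :=
  a + b * x.1 + c * x.2 + d * (x.1 * x.2) + e * (x.1 * x.1) + f * (x.1 * x.1 * x.2)

lemma hasFDerivAt_ofReal_fst (x : ℝ × ℝ) :
    HasFDerivAt (fun y : ℝ × ℝ => (y.1 : ℂ))
      (Complex.ofRealCLM.comp (ContinuousLinearMap.fst ℝ ℝ ℝ)) x :=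
  (Complex.ofRealCLM.comp (ContinuousLinearMap.fst ℝ ℝ ℝ)).hasFDerivAt

lemma hasFDerivAt_ofReal_snd (x : ℝ × ℝ) :
    HasFDerivAt (fun y : ℝ × ℝ => (y.2 : ℂ))
      (Complex.ofRealCLM.comp (ContinuousLinearMap.snd ℝ ℝ ℝ)) x :=
  (Complex.ofRealCLM.comp (ContinuousLinearMap.snd ℝ ℝ ℝ)).hasFDerivAt

/-- The family `cubic` is stable under both partial derivatives, so iterated derivatives of
$\lambda_X$ reduce to bookkeeping on six coefficients. -/
lemma pd_cubic (a b c d e f : ℂ) (i : Fin 2) (x : ℝ × ℝ) :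
    pd i (cubic a b c d e f) x = (b + d * x.2 + 2 * e * x.1 + 2 * f * (x.1 * x.2)) * ![1, 0] i
      + (c + d * x.1 + f * (x.1 * x.1)) * ![0, 1] i := by
  have h1 := hasFDerivAt_ofReal_fst x
  have h2 := hasFDerivAt_ofReal_snd x
  have h : HasFDerivAt (cubic a b c d e f) _ x :=
    ((((((hasFDerivAt_const a x).add (h1.const_mul b)).add (h2.const_mul c)).add
      ((h1.mul h2).const_mul d)).add ((h1.mul h1).const_mul e)).add
      (((h1.mul h1).mul h2).const_mul f))
  rw [pd, h.fderiv]
  fin_cases i <;> simp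
  ring

lemma pd_zero_cubic (a b c d e f : ℂ) :
    pd 0 (cubic a b c d e f) = cubic b (2 * e) d (2 * f) 0 0 := by
  ext x
  simp [pd_cubic, cubic]
  ring

lemma pd_one_cubic (a b c d e f : ℂ) :
    pd 1 (cubic a b c d e f) = cubic c d 0 0 f 0 := by
  ext x
  simp [pd_cubic, cubic]

lemma cubic_zero : cubic 0 0 0 0 0 0 = 0 := by
  ext x
  simp [cubic]

lemma moment_eq_cubic (X : sl2) : moment X = cubic (X.1 0 0) (-X.1 1 0) (X.1 0 1) (2 * X.1 0 0) 0
    (-X.1 1 0) := by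
  ext x
  rw [moment, β_chart, cubic]
  push_cast
  ring

lemma pd_zero (i : Fin 2) : pd i 0 = 0 := by
  ext y
  simp [pd]

lemma bidiff_zero_left (k : ℕ) (v : ℝ × ℝ → ℂ) (x : ℝ × ℝ) : bidiff k 0 v x = 0 := by
  induction k generalizing v with
  | zero => simp [bidiff]
  | succ k ih =>
    simp [bidiff, pd_zero, ih]

/-- Each contraction with the antisymmetric tensor `Λ` contributes one sign. -/
lemma bidiff_swap (k : ℕ) (u v : ℝ × ℝ → ℂ) (x : ℝ × ℝ) :
    bidiff k v u x = (-1) ^ k * bidiff k u v x := by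
  induction k generalizing u v with
  | zero => simp [bidiff, mul_comm]
  | succ k ih =>
    simp only [bidiff, Fin.sum_univ_two, Λ]
    rw [ih (pd 1 u) (pd 0 v), ih (pd 0 u) (pd 1 v), ih (pd 1 u) (pd 1 v), ih (pd 0 u) (pd 0 v)]
    simp
    ring

lemma bidiff_moment_add_four (X : sl2) (k : ℕ) (u : ℝ × ℝ → ℂ) (x : ℝ × ℝ) :
    bidiff (k + 4) (moment X) u x = 0 := by
  simp [bidiff, Fin.sum_univ_two, Λ, moment_eq_cubic, pd_zero_cubic, pd_one_cubic, cubic_zero,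
    pd_zero, bidiff_zero_left]

lemma moyal_moment_left (ν : ℝ) (X : sl2) (u : ℝ × ℝ → ℂ) (x : ℝ × ℝ) :
    moyal ν (moment X) u x = ∑ k ∈ Finset.range 4,
      ((ν : ℂ) ^ k / (k.factorial : ℂ)) * bidiff k (moment X) u x := by
  refine tsum_eq_sum fun k hk => ?_
  obtain ⟨m, rfl⟩ := Nat.exists_eq_add_of_le' (not_lt.1 (Finset.mem_range.not.1 hk))
  rw [bidiff_moment_add_four, mul_zero]

lemma moyal_moment_right (ν : ℝ) (X : sl2) (u : ℝ × ℝ → ℂ) (x : ℝ × ℝ) :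
    moyal ν u (moment X) x = ∑ k ∈ Finset.range 4,
      ((ν : ℂ) ^ k / (k.factorial : ℂ)) * ((-1) ^ k * bidiff k (moment X) u x) := by
  simp only [← bidiff_swap]
  refine tsum_eq_sum fun k hk => ?_
  obtain ⟨m, rfl⟩ := Nat.exists_eq_add_of_le' (not_lt.1 (Finset.mem_range.not.1 hk))
  rw [bidiff_swap _ (moment X), bidiff_moment_add_four, mul_zero, mul_zero]

/-- In the commutator the even orders cancel and the odd ones double; dividing by $2\nu$ leaves
$\nu^{k-1}/k!$ for $k=1,3$. -/
lemma adStar_eq_bidiff {ν : ℝ} (hν : ν ≠ 0) (X : sl2) (u : ℝ × ℝ → ℂ) (x : ℝ × ℝ) :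
    adStar ν X u x = bidiff 1 (moment X) u x + (ν : ℂ) ^ 2 / 6 * bidiff 3 (moment X) u x := by
  have hν' : (ν : ℂ) ≠ 0 := by exact_mod_cast hν
  rw [adStar, moyal_moment_left, moyal_moment_right]
  simp only [Finset.sum_range_succ, Finset.sum_range_zero, Nat.factorial]
  field_simp
  push_cast
  ring

/-- The only third derivative of $\lambda_X$ that survives is $\partial_l^2\partial_{l'}$. The three
orderings of the dual operator on $u$ stay separate, since $u$ is arbitrary here and its partial
derivatives need not commute. -/
lemma adStar_eq {ν : ℝ} (hν : ν ≠ 0) (X : sl2) (u : ℝ × ℝ → ℂ) (x : ℝ × ℝ) :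
    adStar ν X u x =
      X.1 0 0 * (2 * x.2 * pd 1 u x - 2 * x.1 * pd 0 u x) - X.1 0 1 * pd 0 u x
      + X.1 1 0 * (x.1 ^ 2 * pd 0 u x - (1 + 2 * x.1 * x.2) * pd 1 u x
        + (ν : ℂ) ^ 2 / 3 * (pd 0 (pd 1 (pd 1 u)) x + pd 1 (pd 0 (pd 1 u)) x
          + pd 1 (pd 1 (pd 0 u)) x)) := by
  rw [adStar_eq_bidiff hν]
  simp [bidiff, Fin.sum_univ_two, Λ, moment_eq_cubic, pd_zero_cubic, pd_one_cubic, cubic]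
  ring

/-! ### The partial Fourier transform of Schwartz functions -/

section PartialFourier

open scoped FourierTransform
open Real (pi)

variable {V : Type*} [NormedAddCommGroup V] [NormedSpace ℂ V]

lemma hasTemperateGrowth_mk (l : ℝ) : (fun v : ℝ => (l, v)).HasTemperateGrowth := by
  have h : (fun v : ℝ => ((l, v) : ℝ × ℝ)) =
      fun v => ((l, 0) : ℝ × ℝ) + ContinuousLinearMap.inr ℝ ℝ ℝ v := by
    ext v <;> simp
  rw [h]
  exact (Function.HasTemperateGrowth.const _).add
    (ContinuousLinearMap.hasTemperateGrowth (ContinuousLinearMap.inr ℝ ℝ ℝ))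

/-- The restriction of a Schwartz function on the plane to a vertical line. -/
def slice (u : 𝓢(ℝ × ℝ, V)) (l : ℝ) : 𝓢(ℝ, V) :=
  SchwartzMap.compCLM ℝ (hasTemperateGrowth_mk l) ⟨1, 1, fun v => by
    rw [pow_one, one_mul]
    exact (norm_snd_le (l, v)).trans (le_add_of_nonneg_left zero_le_one)⟩ u

@[simp] lemma slice_apply (u : 𝓢(ℝ × ℝ, V)) (l v : ℝ) : slice u l v = u (l, v) := rfl

/-- The Fourier transform in the second variable. -/
def fourierSnd (u : 𝓢(ℝ × ℝ, V)) (x : ℝ × ℝ) : V := 𝓕 (slice u x.1) x.2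

lemma fourierSnd_eq (u : 𝓢(ℝ × ℝ, V)) (x : ℝ × ℝ) :
    fourierSnd u x = ∫ v : ℝ, Real.fourierChar (-(v * x.2)) • u (x.1, v) := by
  rw [fourierSnd, SchwartzMap.fourier_coe, Real.fourier_real_eq]
  rfl

/-- Supplies an integrable majorant in the second variable that is uniform in the first, for use
under the integral sign. -/
lemma exists_decay_snd (u : 𝓢(ℝ × ℝ, V)) : ∃ C, ∀ x, ‖u x‖ ≤ C * (1 + x.2 ^ 2)⁻¹ := by
  refine ⟨SchwartzMap.seminorm ℝ 0 0 u + SchwartzMap.seminorm ℝ 2 0 u, fun x => ?_⟩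
  have h0 := SchwartzMap.norm_le_seminorm ℝ u x
  have h2 := SchwartzMap.norm_pow_mul_le_seminorm ℝ u 2 x
  have h : x.2 ^ 2 ≤ ‖x‖ ^ 2 := by
    rw [← sq_abs]
    exact pow_le_pow_left₀ (abs_nonneg _) (norm_snd_le x) 2
  rw [← div_eq_mul_inv, le_div_iff₀ (by positivity)]
  nlinarith [norm_nonneg (u x)]

lemma norm_fourierSnd_le (u : 𝓢(ℝ × ℝ, V)) : ∃ C, ∀ x, ‖fourierSnd u x‖ ≤ C := by
  obtain ⟨C, hC⟩ := exists_decay_snd u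
  refine ⟨∫ v : ℝ, C * (1 + v ^ 2)⁻¹, fun x => ?_⟩
  rw [fourierSnd_eq]
  refine norm_integral_le_of_norm_le (integrable_inv_one_add_sq.const_mul C)
    (Filter.Eventually.of_forall fun v => ?_)
  rw [Circle.norm_smul]
  exact hC (x.1, v)

/-- The Schwartz function whose Fourier transform in the second variable is the derivative of
that of `u`. -/
def fourierSndDeriv (u : 𝓢(ℝ × ℝ, V)) : 𝓢(ℝ × ℝ, ℝ × ℝ →L[ℝ] V) :=
  SchwartzMap.postcompCLM ((ContinuousLinearMap.compL ℝ (ℝ × ℝ) (ℝ × ℝ) V).flip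
      ((ContinuousLinearMap.inl ℝ ℝ ℝ).comp (ContinuousLinearMap.fst ℝ ℝ ℝ)))
    (SchwartzMap.fderivCLM ℝ (ℝ × ℝ) V u)
  - (2 * pi * Complex.I) • SchwartzMap.smulRightCLM ℂ V
      ((ContinuousLinearMap.snd ℝ ℝ ℝ).smulRight (ContinuousLinearMap.snd ℝ ℝ ℝ)) u

lemma fourierSndDeriv_apply (u : 𝓢(ℝ × ℝ, V)) (x y : ℝ × ℝ) :
    fourierSndDeriv u x y =
      fderiv ℝ u x (y.1, 0) - (2 * pi * Complex.I) • (x.2 * y.2) • u x := by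
  simp [fourierSndDeriv]

lemma hasFDerivAt_fourierChar_smul (u : 𝓢(ℝ × ℝ, V)) (v : ℝ) (x : ℝ × ℝ) :
    HasFDerivAt (fun x : ℝ × ℝ => Real.fourierChar (-(v * x.2)) • u (x.1, v))
      (Real.fourierChar (-(v * x.2)) • fourierSndDeriv u (x.1, v)) x := by
  have h1 : HasFDerivAt (fun x : ℝ × ℝ => (Real.fourierChar (-(v * x.2)) : ℂ)) _ x :=
    HasFDerivAt.comp (g := fun y => (Real.fourierChar y : ℂ)) (f := fun x : ℝ × ℝ => -(v * x.2)) x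
      (Real.hasDerivAt_fourierChar (-(v * x.2))).hasFDerivAt
      ((hasFDerivAt_snd (𝕜 := ℝ) (p := x)).const_mul v).neg
  have h2 : HasFDerivAt (fun x : ℝ × ℝ => u (x.1, v)) _ x :=
    (u.hasFDerivAt (x.1, v)).comp x ((hasFDerivAt_fst (𝕜 := ℝ) (p := x)).prodMk
      (hasFDerivAt_const v x))
  refine (h1.smul h2).congr_fderiv (ContinuousLinearMap.ext fun y => ?_)
  have h3 : (Real.fourierChar (-(v * x.2)) • fourierSndDeriv u (x.1, v)) y
      = (Real.fourierChar (-(v * x.2)) : ℂ) • fourierSndDeriv u (x.1, v) y := rfl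
  rw [h3, fourierSndDeriv_apply, smul_sub, sub_eq_add_neg, ← smul_neg, ← neg_smul]
  simp only [_root_.add_apply, _root_.smul_apply, ContinuousLinearMap.comp_apply,
    ContinuousLinearMap.smulRight_apply]
  congr 1
  rw [← Complex.coe_smul, smul_smul, smul_smul]
  congr 1
  simp
  ring

lemma hasFDerivAt_fourierSnd (u : 𝓢(ℝ × ℝ, V)) (x : ℝ × ℝ) :
    HasFDerivAt (fourierSnd u) (fourierSnd (fourierSndDeriv u) x) x := by
  obtain ⟨C, hC⟩ := exists_decay_snd (fourierSndDeriv u)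
  have hc : ∀ {W : Type _} [NormedAddCommGroup W] [NormedSpace ℂ W] (w : 𝓢(ℝ × ℝ, W)) (x : ℝ × ℝ),
      Continuous fun v : ℝ => Real.fourierChar (-(v * x.2)) • w (x.1, v) := fun w x => by
    have := w.continuous
    have := Real.continuous_fourierChar
    fun_prop
  rw [fourierSnd_eq, show fourierSnd u = _ from funext (fourierSnd_eq u)]
  refine hasFDerivAt_integral_of_dominated_of_fderiv_le (𝕜 := ℝ) (s := Set.univ)
    (bound := fun v => C * (1 + v ^ 2)⁻¹) Filter.univ_mem
    (Filter.Eventually.of_forall fun y => (hc u y).aestronglyMeasurable) ?_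
    (hc _ x).aestronglyMeasurable (Filter.Eventually.of_forall fun v y _ => ?_)
    (integrable_inv_one_add_sq.const_mul C)
    (Filter.Eventually.of_forall fun v y _ => hasFDerivAt_fourierChar_smul u v y)
  · obtain ⟨C', hC'⟩ := exists_decay_snd u
    refine (integrable_inv_one_add_sq.const_mul C').mono' (hc u x).aestronglyMeasurable
      (Filter.Eventually.of_forall fun v => ?_)
    rw [Circle.norm_smul]
    exact hC' (x.1, v)
  · exact (Circle.norm_smul _ _).trans_le (hC (y.1, v))

/-- The derivative is again a partial transform, of a Schwartz function with values in a space of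
linear maps. The induction therefore has to run over all target spaces `V` at once. -/
lemma contDiff_fourierSnd (n : ℕ) (u : 𝓢(ℝ × ℝ, V)) : ContDiff ℝ n (fourierSnd u) := by
  induction n generalizing V with
  | zero =>
    exact contDiff_zero.2
      (continuous_iff_continuousAt.2 fun x => (hasFDerivAt_fourierSnd u x).continuousAt)
  | succ n ih =>
    push_cast
    refine contDiff_succ_iff_fderiv.2 ⟨fun x => (hasFDerivAt_fourierSnd u x).differentiableAt,
      by simp, ?_⟩
    rw [show fderiv ℝ (fourierSnd u) = _ from funext fun x => (hasFDerivAt_fourierSnd u x).fderiv]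
    exact ih (fourierSndDeriv u)

/-- Multiplication by the first coordinate. -/
def mulFst (u : 𝓢(ℝ × ℝ, V)) : 𝓢(ℝ × ℝ, V) :=
  SchwartzMap.smulLeftCLM V (fun x : ℝ × ℝ => x.1) u

/-- Multiplication by the second coordinate. -/
def mulSnd (u : 𝓢(ℝ × ℝ, V)) : 𝓢(ℝ × ℝ, V) :=
  SchwartzMap.smulLeftCLM V (fun x : ℝ × ℝ => x.2) u

/-- The partial derivatives of a Schwartz function. -/
def pdS (i : Fin 2) (u : 𝓢(ℝ × ℝ, V)) : 𝓢(ℝ × ℝ, V) :=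
  SchwartzMap.evalCLM ℝ (ℝ × ℝ) V (![((1 : ℝ), (0 : ℝ)), ((0 : ℝ), (1 : ℝ))] i)
    (SchwartzMap.fderivCLM ℝ (ℝ × ℝ) V u)

@[simp] lemma mulFst_apply (u : 𝓢(ℝ × ℝ, V)) (x : ℝ × ℝ) : mulFst u x = x.1 • u x :=
  SchwartzMap.smulLeftCLM_apply_apply
    (ContinuousLinearMap.hasTemperateGrowth (ContinuousLinearMap.fst ℝ ℝ ℝ)) u x

@[simp] lemma mulSnd_apply (u : 𝓢(ℝ × ℝ, V)) (x : ℝ × ℝ) : mulSnd u x = x.2 • u x :=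
  SchwartzMap.smulLeftCLM_apply_apply
    (ContinuousLinearMap.hasTemperateGrowth (ContinuousLinearMap.snd ℝ ℝ ℝ)) u x

lemma pdS_apply (i : Fin 2) (u : 𝓢(ℝ × ℝ, V)) (x : ℝ × ℝ) :
    pdS i u x = fderiv ℝ u x (![((1 : ℝ), (0 : ℝ)), ((0 : ℝ), (1 : ℝ))] i) := rfl

lemma fourierSnd_mulFst (u : 𝓢(ℝ × ℝ, V)) (x : ℝ × ℝ) :
    fourierSnd (mulFst u) x = x.1 • fourierSnd u x := by
  simp only [fourierSnd_eq, mulFst_apply]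
  rw [← integral_smul]
  congr 1 with v
  rw [smul_comm]

lemma slice_pdS_one (u : 𝓢(ℝ × ℝ, V)) (l v : ℝ) : slice (pdS 1 u) l v = deriv (slice u l) v := by
  have h : HasDerivAt (fun v => u (l, v)) (fderiv ℝ u (l, v) (0, 1)) v :=
    (u.hasFDerivAt (l, v)).comp_hasDerivAt v ((hasDerivAt_const v l).prodMk (hasDerivAt_id v))
  exact h.deriv.symm

lemma fourierSnd_pdS_one (u : 𝓢(ℝ × ℝ, V)) (x : ℝ × ℝ) :
    fourierSnd (pdS 1 u) x = (2 * pi * Complex.I * x.2) • fourierSnd u x := by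
  have h : slice (pdS 1 u) x.1 = SchwartzMap.derivCLM ℝ V (slice u x.1) := by
    ext v
    exact slice_pdS_one u x.1 v
  have := Real.fourier_deriv (slice u x.1).integrable (slice u x.1).differentiable
    (SchwartzMap.derivCLM ℝ V (slice u x.1)).integrable
  rw [fourierSnd, h, SchwartzMap.fourier_coe]
  exact congrFun this x.2

lemma fourierSnd_iterate_mulFst (k : ℕ) (u : 𝓢(ℝ × ℝ, V)) (x : ℝ × ℝ) :
    fourierSnd (mulFst^[k] u) x = x.1 ^ k • fourierSnd u x := by
  induction k generalizing u with
  | zero => simp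
  | succ k ih => rw [Function.iterate_succ_apply, ih, fourierSnd_mulFst, smul_smul, pow_succ]

lemma fourierSnd_iterate_pdS_one (k : ℕ) (u : 𝓢(ℝ × ℝ, V)) (x : ℝ × ℝ) :
    fourierSnd ((pdS 1)^[k] u) x = (2 * pi * Complex.I * x.2) ^ k • fourierSnd u x := by
  induction k generalizing u with
  | zero => simp
  | succ k ih => rw [Function.iterate_succ_apply, ih, fourierSnd_pdS_one, smul_smul, pow_succ]

/-- Powers of either coordinate can be absorbed into $u$: the first commutes with the transform, the
second comes from $\partial_{l'}$. Boundedness of all partial transforms then gives decay, and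
`fourierSndDeriv` lowers the order of differentiation. -/
lemma decay_fourierSnd (k n : ℕ) (u : 𝓢(ℝ × ℝ, V)) :
    ∃ C : ℝ, ∀ x, ‖x‖ ^ k * ‖iteratedFDeriv ℝ n (fourierSnd u) x‖ ≤ C := by
  induction n generalizing V with
  | zero =>
    obtain ⟨C₁, hC₁⟩ := norm_fourierSnd_le (mulFst^[k] u)
    obtain ⟨C₂, hC₂⟩ := norm_fourierSnd_le ((pdS 1)^[k] u)
    refine ⟨C₁ + C₂, fun x => ?_⟩
    have h1 := hC₁ x
    have h2 := hC₂ x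
    rw [fourierSnd_iterate_mulFst, norm_smul, norm_pow] at h1
    rw [fourierSnd_iterate_pdS_one, norm_smul, norm_pow] at h2
    have h3 : ‖x.2‖ ≤ ‖2 * (pi : ℂ) * Complex.I * x.2‖ := by
      have := Real.pi_gt_three
      simp only [norm_mul, Complex.norm_I, Complex.norm_real, RCLike.norm_ofNat, mul_one,
        Real.norm_eq_abs, abs_of_pos Real.pi_pos]
      nlinarith [abs_nonneg x.2]
    have h4 : ‖x.2‖ ^ k * ‖fourierSnd u x‖ ≤ C₂ := le_trans (by gcongr) h2
    rw [norm_iteratedFDeriv_zero]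
    have hC₁0 := (norm_nonneg _).trans (hC₁ 0)
    have hC₂0 := (norm_nonneg _).trans (hC₂ 0)
    -- The product carries the sup norm, so a bound for each coordinate separately is enough.
    rcases max_choice ‖x.1‖ ‖x.2‖ with h | h <;> rw [Prod.norm_def, h] <;> linarith
  | succ n ih =>
    obtain ⟨C, hC⟩ := ih (fourierSndDeriv u)
    refine ⟨C, fun x => ?_⟩
    rw [← norm_iteratedFDeriv_fderiv,
      show fderiv ℝ (fourierSnd u) = _ from funext fun x => (hasFDerivAt_fourierSnd u x).fderiv]
    exact hC x

/-- The Fourier transform in the second variable, as a map between Schwartz spaces. -/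
def fourierSndS (u : 𝓢(ℝ × ℝ, V)) : 𝓢(ℝ × ℝ, V) where
  toFun := fourierSnd u
  smooth' := contDiff_infty.2 fun n => contDiff_fourierSnd n u
  decay' k n := decay_fourierSnd k n u

@[simp] lemma fourierSndS_apply (u : 𝓢(ℝ × ℝ, V)) (x : ℝ × ℝ) :
    fourierSndS u x = fourierSnd u x := rfl

lemma slice_fourierSndS (u : 𝓢(ℝ × ℝ, V)) (l : ℝ) : slice (fourierSndS u) l = 𝓕 (slice u l) := rfl

/-- Precomposition with the reflection `(l, v) ↦ (l, -v)`. -/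
def reflectSnd (u : 𝓢(ℝ × ℝ, V)) : 𝓢(ℝ × ℝ, V) :=
  SchwartzMap.compCLMOfContinuousLinearEquiv ℝ
    ((ContinuousLinearEquiv.refl ℝ ℝ).prodCongr (ContinuousLinearEquiv.neg ℝ)) u

lemma slice_reflectSnd_fourierSndS [CompleteSpace V] (u : 𝓢(ℝ × ℝ, V)) (l : ℝ) :
    slice (reflectSnd (fourierSndS u)) l = 𝓕⁻ (slice u l) := by
  ext v
  rw [SchwartzMap.fourierInv_coe, Real.fourierInv_eq_fourier_neg]
  rfl

/-- The Fourier transform in the second variable, as a linear automorphism of Schwartz space. -/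
def fourierSndEquiv [CompleteSpace V] : 𝓢(ℝ × ℝ, V) ≃ₗ[ℂ] 𝓢(ℝ × ℝ, V) where
  toFun := fourierSndS
  invFun u := reflectSnd (fourierSndS u)
  map_add' u v := by
    ext x
    change 𝓕 (slice (u + v) x.1) x.2 = 𝓕 (slice u x.1) x.2 + 𝓕 (slice v x.1) x.2
    rw [show slice (u + v) x.1 = slice u x.1 + slice v x.1 from rfl, FourierTransform.fourier_add]
    rfl
  map_smul' c u := by
    ext x
    change 𝓕 (slice (c • u) x.1) x.2 = c • 𝓕 (slice u x.1) x.2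
    rw [show slice (c • u) x.1 = c • slice u x.1 from rfl, FourierTransform.fourier_smul]
    rfl
  left_inv u := by
    ext x
    change slice (reflectSnd (fourierSndS (fourierSndS u))) x.1 x.2 = _
    rw [slice_reflectSnd_fourierSndS, slice_fourierSndS, FourierTransform.fourierInv_fourier_eq]
    rfl
  right_inv u := by
    ext x
    change 𝓕 (slice (reflectSnd (fourierSndS u)) x.1) x.2 = _
    rw [slice_reflectSnd_fourierSndS, FourierTransform.fourier_fourierInv_eq]
    rfl

lemma integrable_inner (f g : 𝓢(ℝ × ℝ, ℂ)) : Integrable fun x => inner ℂ (f x) (g x) := by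
  refine (L2.integrable_inner (𝕜 := ℂ) (f.toLp 2 volume) (g.toLp 2 volume)).congr ?_
  filter_upwards [f.coeFn_toLp 2 volume, g.coeFn_toLp 2 volume] with x hf hg
  rw [hf, hg]

/-- Plancherel on each vertical line, integrated over the lines by Fubini. -/
lemma norm_toLp_fourierSndS (u : 𝓢(ℝ × ℝ, ℂ)) :
    ‖(fourierSndS u).toLp 2 volume‖ = ‖u.toLp 2 volume‖ := by
  simp_rw [@norm_eq_sqrt_re_inner ℂ, SchwartzMap.inner_toL2_toL2_eq]
  rw [Measure.volume_eq_prod, integral_prod _ (integrable_inner _ _),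
    integral_prod _ (integrable_inner _ _)]
  congr 3 with l
  exact SchwartzMap.integral_inner_fourier_fourier (slice u l) (slice u l)

/-- The Fourier transform in the second variable, as a unitary operator of `L²(ℝ²)`. -/
def fourierSndL2 : L2Plane ≃ₗᵢ[ℂ] L2Plane :=
  fourierSndEquiv.extendOfIsometry (SchwartzMap.toLpCLM ℂ ℂ 2 volume).toLinearMap
    (SchwartzMap.toLpCLM ℂ ℂ 2 volume).toLinearMap
    (SchwartzMap.denseRange_toLpCLM ENNReal.ofNat_ne_top)
    (SchwartzMap.denseRange_toLpCLM ENNReal.ofNat_ne_top) norm_toLp_fourierSndS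

lemma fourierSndL2_toLp (u : 𝓢(ℝ × ℝ, ℂ)) :
    fourierSndL2 (u.toLp 2 volume) = (fourierSndS u).toLp 2 volume :=
  LinearEquiv.extendOfIsometry_eq _ _ _ _ _ norm_toLp_fourierSndS u

lemma partialFourier_eq (u : 𝓢(ℝ × ℝ, ℂ)) (y : ℝ × ℝ) :
    partialFourier u y = fourierSnd u (y.1, y.2 / (2 * pi)) := by
  rw [fourierSnd, SchwartzMap.fourier_coe, Real.fourier_real_eq_integral_exp_smul, partialFourier]
  congr 1 with v
  rw [Ω_smul_E_smul_F, slice_apply, smul_eq_mul]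
  congr 2
  have := Real.pi_ne_zero
  rw [show -2 * pi * v * (y.2 / (2 * pi)) = -(y.2 * v) by field_simp]
  push_cast
  ring

end PartialFourier

/-! ### Weighted composition operators on `L²` -/

section WeightedComp

open scoped ENNReal

variable {α β : Type*} [MeasurableSpace α] [MeasurableSpace β] {μ : Measure α} {ν : Measure β}

/-- The data of an isometric weighted composition operator `f ↦ w · (f ∘ φ)` on `L²`. -/
structure IsIsometricWeight (μ : Measure α) (ν : Measure β) (w : α → ℂ) (φ : α → β) : Prop where
  measurable_weight : Measurable w
  measurable_map : Measurable φ
  ne_zero : ∀ᵐ x ∂μ, w x ≠ 0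
  lintegral_eq : ∀ f : β → ℝ≥0∞, Measurable f → ∫⁻ x, ‖w x‖ₑ ^ 2 * f (φ x) ∂μ = ∫⁻ y, f y ∂ν

variable {w : α → ℂ} {φ : α → β}

/-- Testing the integral identity on the indicator of a null set shows that $|w|^2$ vanishes a.e. on
its preimage, while $w\ne0$ a.e. This makes $f\circ\varphi$ well defined on classes. -/
lemma IsIsometricWeight.quasiMeasurePreserving (h : IsIsometricWeight μ ν w φ) :
    Measure.QuasiMeasurePreserving φ μ ν := by
  refine ⟨h.measurable_map, Measure.AbsolutelyContinuous.mk fun s hs hs0 => ?_⟩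
  have h1 := h.lintegral_eq (s.indicator 1) (measurable_one.indicator hs)
  have hm : Measurable fun x => ‖w x‖ₑ ^ 2 * s.indicator (1 : β → ℝ≥0∞) (φ x) :=
    (h.measurable_weight.enorm.pow_const 2).mul
      ((measurable_one.indicator hs).comp h.measurable_map)
  rw [lintegral_indicator_one hs, hs0, lintegral_eq_zero_iff hm] at h1
  rw [Measure.map_apply h.measurable_map hs, measure_eq_zero_iff_ae_notMem]
  filter_upwards [h1, h.ne_zero] with x hx hw hxs
  simp [Set.indicator_of_mem (show φ x ∈ s from hxs), hw] at hx

lemma IsIsometricWeight.eLpNorm_eq (h : IsIsometricWeight μ ν w φ) {f : β → ℂ}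
    (hf : StronglyMeasurable f) : eLpNorm (fun x => w x * f (φ x)) 2 μ = eLpNorm f 2 ν := by
  rw [eLpNorm_eq_lintegral_rpow_enorm_toReal two_ne_zero ENNReal.ofNat_ne_top,
    eLpNorm_eq_lintegral_rpow_enorm_toReal two_ne_zero ENNReal.ofNat_ne_top,
    ← h.lintegral_eq _ (hf.measurable.enorm.pow_const _)]
  simp [enorm_mul, mul_pow]

lemma IsIsometricWeight.memLp (h : IsIsometricWeight μ ν w φ) (f : Lp ℂ 2 ν) :
    MemLp (fun x => w x * f (φ x)) 2 μ :=
  ⟨(h.measurable_weight.mul ((Lp.stronglyMeasurable f).measurable.comp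
    h.measurable_map)).aestronglyMeasurable, by
    rw [h.eLpNorm_eq (Lp.stronglyMeasurable f)]
    exact (Lp.memLp f).2⟩

/-- The isometry `f ↦ w · (f ∘ φ)` between `L²` spaces. -/
def weightedComp (h : IsIsometricWeight μ ν w φ) : Lp ℂ 2 ν →ₗᵢ[ℂ] Lp ℂ 2 μ where
  toFun f := (h.memLp f).toLp
  map_add' f g := by
    refine Lp.ext ?_
    filter_upwards [(h.memLp (f + g)).coeFn_toLp, (h.memLp f).coeFn_toLp, (h.memLp g).coeFn_toLp,
      Lp.coeFn_add (h.memLp f).toLp (h.memLp g).toLp,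
      h.quasiMeasurePreserving.ae (Lp.coeFn_add f g)] with x h1 h2 h3 h4 h5
    simp only [h4, h1, h2, h3, h5, Pi.add_apply, mul_add]
  map_smul' c f := by
    refine Lp.ext ?_
    filter_upwards [(h.memLp (c • f)).coeFn_toLp, (h.memLp f).coeFn_toLp,
      Lp.coeFn_smul c (h.memLp f).toLp,
      h.quasiMeasurePreserving.ae (Lp.coeFn_smul c f)] with x h1 h2 h4 h5
    simp only [RingHom.id_apply, h4, h1, h2, h5, Pi.smul_apply, smul_eq_mul]
    ring
  norm_map' f := by
    change ‖(h.memLp f).toLp‖ = _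
    rw [Lp.norm_toLp, h.eLpNorm_eq (Lp.stronglyMeasurable f), Lp.norm_def]

lemma coeFn_weightedComp (h : IsIsometricWeight μ ν w φ) (f : Lp ℂ 2 ν) :
    weightedComp h f =ᵐ[μ] fun x => w x * f (φ x) := (h.memLp f).coeFn_toLp

lemma coeFn_weightedComp_of_ae_eq (h : IsIsometricWeight μ ν w φ) {f : Lp ℂ 2 ν} {f' : β → ℂ}
    (hf : f =ᵐ[ν] f') : weightedComp h f =ᵐ[μ] fun x => w x * f' (φ x) := by
  filter_upwards [coeFn_weightedComp h f, h.quasiMeasurePreserving.ae hf] with x h1 h2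
  rw [h1, h2]

end WeightedComp

/-! ### Möbius transformations and the principal series -/

/-- The denominator `cz + d` of a Möbius transformation. -/
def den (g : SL(2, ℂ)) (z : ℂ) : ℂ := g 1 0 * z + g 1 1

/-- The Möbius transformation `z ↦ (az + b) / (cz + d)`. -/
def moeb (g : SL(2, ℂ)) (z : ℂ) : ℂ := (g 0 0 * z + g 0 1) / (g 1 0 * z + g 1 1)

/-- The weight `|j|⁻² (j / |j|)^ℓ` of the principal series. -/
def psWeight (ℓ : ℤ) (j : ℂ) : ℂ := (‖j‖ : ℂ) ^ (-2 : ℂ) * (j / (‖j‖ : ℂ)) ^ ℓ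

lemma principalSeries_eq (ℓ : ℤ) (g : SL(2, ℂ)) (f : ℂ → ℂ) (z : ℂ) :
    principalSeries (-2) ℓ g f z = psWeight ℓ (den g⁻¹ z) * f (moeb g⁻¹ z) := rfl

lemma det_eq (g : SL(2, ℂ)) : g 0 0 * g 1 1 - g 0 1 * g 1 0 = 1 := by
  rw [← Matrix.det_fin_two]
  exact g.2

/-- The cocycle identity behind multiplicativity of the principal series. The pole of `h` is
excluded because `moeb h` has a meaningless value there. -/
lemma den_mul (g h : SL(2, ℂ)) {z : ℂ} (hz : den h z ≠ 0) :
    den (g * h) z = den g (moeb h z) * den h z := by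
  unfold den moeb at *
  simp only [Matrix.SpecialLinearGroup.coe_mul, Matrix.mul_apply, Fin.sum_univ_two]
  field_simp
  ring

lemma moeb_mul (g h : SL(2, ℂ)) {z : ℂ} (hz : den h z ≠ 0) :
    moeb (g * h) z = moeb g (moeb h z) := by
  unfold den at hz
  unfold moeb
  rw [mul_div_assoc', div_add' _ _ _ hz, mul_div_assoc', div_add' _ _ _ hz,
    div_div_div_cancel_right₀ hz]
  simp only [Matrix.SpecialLinearGroup.coe_mul, Matrix.mul_apply, Fin.sum_univ_two]
  congr 1 <;> ring

@[simp] lemma den_one (z : ℂ) : den 1 z = 1 := by simp [den]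

@[simp] lemma moeb_one (z : ℂ) : moeb 1 z = z := by simp [moeb]

lemma psWeight_mul (ℓ : ℤ) {i j : ℂ} (hi : i ≠ 0) (hj : j ≠ 0) :
    psWeight ℓ (i * j) = psWeight ℓ i * psWeight ℓ j := by
  have hi' : (‖i‖ : ℂ) ≠ 0 := by simpa using hi
  have hj' : (‖j‖ : ℂ) ≠ 0 := by simpa using hj
  rw [psWeight, psWeight, psWeight, norm_mul, Complex.ofReal_mul, mul_div_mul_comm, mul_zpow,
    Complex.mul_cpow_ofReal_nonneg (norm_nonneg _) (norm_nonneg _)]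
  ring

@[simp] lemma psWeight_one (ℓ : ℤ) : psWeight ℓ 1 = 1 := by simp [psWeight]

lemma psWeight_ne_zero (ℓ : ℤ) {j : ℂ} (hj : j ≠ 0) : psWeight ℓ j ≠ 0 := by
  intro h
  have := psWeight_mul ℓ hj (inv_ne_zero hj)
  rw [mul_inv_cancel₀ hj, h, psWeight_one, zero_mul] at this
  exact one_ne_zero this

lemma psWeight_eq (ℓ : ℤ) (j : ℂ) : psWeight ℓ j = ((‖j‖ : ℂ) ^ 2)⁻¹ * (j / (‖j‖ : ℂ)) ^ ℓ := by
  rw [psWeight, Complex.cpow_neg]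
  norm_num

lemma norm_psWeight (ℓ : ℤ) {j : ℂ} (hj : j ≠ 0) : ‖psWeight ℓ j‖ = (‖j‖ ^ 2)⁻¹ := by
  rw [psWeight_eq, norm_mul, norm_zpow, norm_div]
  simp [hj]

lemma measurable_psWeight (ℓ : ℤ) : Measurable (psWeight ℓ) := by
  unfold psWeight
  fun_prop

lemma measurable_moeb (g : SL(2, ℂ)) : Measurable (moeb g) := by
  unfold moeb
  fun_prop

lemma measurable_den (g : SL(2, ℂ)) : Measurable (den g) := by
  unfold den
  fun_prop

lemma ae_mul_add_ne_zero {c d : ℂ} (h : c ≠ 0 ∨ d ≠ 0) : ∀ᵐ z : ℂ, c * z + d ≠ 0 := by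
  rcases eq_or_ne c 0 with rfl | hc
  · simpa using h
  · filter_upwards [compl_mem_ae_iff.2 (measure_singleton (-d / c))] with z hz h0
    refine hz ?_
    rw [Set.mem_singleton_iff, eq_div_iff hc]
    linear_combination h0

lemma ae_den_ne_zero (g : SL(2, ℂ)) : ∀ᵐ z : ℂ, den g z ≠ 0 := by
  refine ae_mul_add_ne_zero (not_and_or.1 fun h => ?_)
  have := det_eq g
  simp [h.1, h.2] at this

lemma hasDerivAt_moeb (g : SL(2, ℂ)) {z : ℂ} (hz : den g z ≠ 0) :
    HasDerivAt (moeb g) ((den g z ^ 2)⁻¹) z := by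
  have h1 := ((hasDerivAt_id z).const_mul (g 0 0)).add_const (g 0 1)
  have h2 := ((hasDerivAt_id z).const_mul (g 1 0)).add_const (g 1 1)
  refine (h1.div h2 hz).congr_deriv ?_
  rw [inv_eq_one_div]
  congr 1
  simp only [id]
  linear_combination det_eq g

lemma den_mul_sub_moeb (g : SL(2, ℂ)) {z : ℂ} (hz : den g z ≠ 0) : den g⁻¹ (moeb g z) ≠ 0 := by
  have := den_mul g⁻¹ g hz
  rw [inv_mul_cancel, den_one] at this
  exact left_ne_zero_of_mul (this ▸ one_ne_zero)

lemma moeb_inv_moeb (g : SL(2, ℂ)) {z : ℂ} (hz : den g z ≠ 0) : moeb g⁻¹ (moeb g z) = z := by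
  rw [← moeb_mul _ _ hz, inv_mul_cancel, moeb_one]

lemma abs_det_smulRight (c : ℂ) :
    |((ContinuousLinearMap.toSpanSingleton ℂ c).restrictScalars ℝ).det| = ‖c‖ ^ 2 := by
  simp [ContinuousLinearMap.det, LinearMap.det_restrictScalars, Algebra.norm_complex_eq,
    Complex.normSq_eq_norm_sq]

/-- The real Jacobian of a Möbius map is $|cz+d|^{-4}$, the square of the modulus of the weight;
this is why $\mu=-2$ is unitary. The poles of the map and of its inverse are null sets. -/
lemma isIsometricWeight_moeb (ℓ : ℤ) (g : SL(2, ℂ)) :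
    IsIsometricWeight volume volume (fun z => psWeight ℓ (den g z)) (moeb g) where
  measurable_weight := (measurable_psWeight ℓ).comp (measurable_den g)
  measurable_map := measurable_moeb g
  ne_zero := (ae_den_ne_zero g).mono fun z hz => psWeight_ne_zero ℓ hz
  lintegral_eq f _ := by
    have hs : MeasurableSet {z | den g z ≠ 0} :=
      (measurableSet_eq_fun (measurable_den g) measurable_const).compl
    have key := lintegral_image_eq_lintegral_abs_det_fderiv_mul volume hs
      (fun z hz => ((hasDerivAt_moeb g hz).hasFDerivAt.restrictScalars ℝ).hasFDerivWithinAt)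
      (fun z hz z' hz' h => by rw [← moeb_inv_moeb g hz, h, moeb_inv_moeb g hz']) f
    have h1 : (moeb g '' {z | den g z ≠ 0}) =ᵐ[volume] Set.univ := by
      refine Filter.eventuallyEq_univ.2 ?_
      filter_upwards [ae_den_ne_zero g⁻¹] with z hz
      refine ⟨moeb g⁻¹ z, ?_, ?_⟩
      · simpa using den_mul_sub_moeb g⁻¹ hz
      · simpa using moeb_inv_moeb g⁻¹ hz
    have h2 : {z | den g z ≠ 0} =ᵐ[volume] Set.univ :=
      Filter.eventuallyEq_univ.2 (ae_den_ne_zero g)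
    rw [setLIntegral_congr h1, setLIntegral_congr h2, setLIntegral_univ, setLIntegral_univ] at key
    rw [key]
    refine lintegral_congr_ae ?_
    filter_upwards [ae_den_ne_zero g] with z hz
    rw [abs_det_smulRight, ← ofReal_norm, ← ENNReal.ofReal_pow (norm_nonneg _), norm_psWeight ℓ hz]
    simp

/-- The principal series operators as isometries. -/
def psIsometry (ℓ : ℤ) (g : SL(2, ℂ)) : L2C →ₗᵢ[ℂ] L2C :=
  weightedComp (isIsometricWeight_moeb ℓ g⁻¹)

lemma coeFn_psIsometry (ℓ : ℤ) (g : SL(2, ℂ)) {f : L2C} {f' : ℂ → ℂ} (hf : f =ᵐ[volume] f') :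
    psIsometry ℓ g f =ᵐ[volume] principalSeries (-2) ℓ g f' :=
  coeFn_weightedComp_of_ae_eq (isIsometricWeight_moeb ℓ g⁻¹) hf

lemma principalSeries_mul (ℓ : ℤ) (g h : SL(2, ℂ)) (f : ℂ → ℂ) {z : ℂ} (hz : den g⁻¹ z ≠ 0)
    (hz' : den (g * h)⁻¹ z ≠ 0) :
    principalSeries (-2) ℓ (g * h) f z =
      principalSeries (-2) ℓ g (principalSeries (-2) ℓ h f) z := by
  simp only [principalSeries_eq]
  rw [_root_.mul_inv_rev] at hz' ⊢
  rw [den_mul _ _ hz] at hz' ⊢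
  rw [moeb_mul _ _ hz, psWeight_mul ℓ (left_ne_zero_of_mul hz') hz]
  ring

lemma psIsometry_mul_apply (ℓ : ℤ) (g h : SL(2, ℂ)) (f : L2C) :
    psIsometry ℓ (g * h) f = psIsometry ℓ g (psIsometry ℓ h f) := by
  refine Lp.ext ?_
  filter_upwards [coeFn_psIsometry ℓ (g * h) (ae_eq_refl f), coeFn_psIsometry ℓ g
    (coeFn_psIsometry ℓ h (ae_eq_refl f)), ae_den_ne_zero g⁻¹, ae_den_ne_zero (g * h)⁻¹]
    with z h1 h2 h3 h4
  rw [h1, h2, principalSeries_mul ℓ g h f h3 h4]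

lemma psIsometry_one_apply (ℓ : ℤ) (f : L2C) : psIsometry ℓ 1 f = f := by
  refine Lp.ext ?_
  filter_upwards [coeFn_psIsometry ℓ 1 (ae_eq_refl f)] with z h1
  rw [h1, principalSeries_eq]
  simp

/-- The principal series representation `𝒫^{-2,ℓ}` of `SL(2, ℂ)` on `L²(ℂ)`. -/
def psRep (ℓ : ℤ) : SL(2, ℂ) →* (L2C ≃ₗᵢ[ℂ] L2C) where
  toFun g :=
    LinearIsometryEquiv.ofSurjective (psIsometry ℓ g) fun f =>
      ⟨psIsometry ℓ g⁻¹ f, by rw [← psIsometry_mul_apply, mul_inv_cancel, psIsometry_one_apply]⟩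
  map_one' := LinearIsometryEquiv.ext (psIsometry_one_apply ℓ)
  map_mul' g h := LinearIsometryEquiv.ext (psIsometry_mul_apply ℓ g h)

lemma psRep_mul_apply (ℓ : ℤ) (g h : SL(2, ℂ)) (f : L2C) :
    psRep ℓ (g * h) f = psRep ℓ g (psRep ℓ h f) := psIsometry_mul_apply ℓ g h f

lemma psRep_one_apply (ℓ : ℤ) (f : L2C) : psRep ℓ 1 f = f := psIsometry_one_apply ℓ f

lemma coeFn_psRep (ℓ : ℤ) (g : SL(2, ℂ)) {f : L2C} {f' : ℂ → ℂ} (hf : f =ᵐ[volume] f') :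
    psRep ℓ g f =ᵐ[volume] principalSeries (-2) ℓ g f' :=
  coeFn_psIsometry ℓ g hf

lemma isPrincipalSeries_psRep (ℓ : ℤ) : IsPrincipalSeries (-2) ℓ (psRep ℓ) :=
  fun g f => coeFn_psRep ℓ g (ae_eq_refl f)

/-! ### A dense invariant space of smooth functions -/

section Core

open scoped ContDiff Topology
open Filter

lemma continuous_den : Continuous fun p : SL(2, ℂ) × ℂ => den p.1 p.2 := by
  unfold den
  fun_prop

lemma continuous_moeb_num :
    Continuous fun p : SL(2, ℂ) × ℂ => p.1 0 0 * p.2 + p.1 0 1 := by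
  fun_prop

lemma continuousAt_moeb {g : SL(2, ℂ)} {z : ℂ} (h : den g z ≠ 0) :
    ContinuousAt (fun p : SL(2, ℂ) × ℂ => moeb p.1 p.2) (g, z) :=
  continuous_moeb_num.continuousAt.div continuous_den.continuousAt h

lemma contDiffAt_psWeight (ℓ : ℤ) {j : ℂ} (hj : j ≠ 0) : ContDiffAt ℝ ∞ (psWeight ℓ) j := by
  have hn : ContDiffAt ℝ ∞ (fun j : ℂ => (‖j‖ : ℂ)) j :=
    Complex.ofRealCLM.contDiff.contDiffAt.comp j (contDiffAt_norm ℝ hj)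
  have hn0 : (‖j‖ : ℂ) ≠ 0 := by simpa using hj
  have hq : ContDiffAt ℝ ∞ (fun j : ℂ => j / (‖j‖ : ℂ)) j := by
    simp only [div_eq_mul_inv]
    exact contDiffAt_id.mul (hn.inv hn0)
  have hz : ContDiffAt ℝ ∞ (fun j : ℂ => (j / (‖j‖ : ℂ)) ^ ℓ) j := by
    cases ℓ with
    | ofNat n => simpa only [Int.ofNat_eq_natCast, zpow_natCast] using hq.pow n
    | negSucc n =>
      simp only [zpow_negSucc]
      exact (hq.pow (n + 1)).inv (pow_ne_zero _ (div_ne_zero hj hn0))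
  rw [show psWeight ℓ = _ from funext (psWeight_eq ℓ)]
  exact ((hn.pow 2).inv (pow_ne_zero _ hn0)).mul hz

lemma continuousAt_psWeight (ℓ : ℤ) {j : ℂ} (hj : j ≠ 0) : ContinuousAt (psWeight ℓ) j :=
  (contDiffAt_psWeight ℓ hj).continuousAt

lemma contDiffAt_moeb (g : SL(2, ℂ)) {z : ℂ} (hz : den g z ≠ 0) : ContDiffAt ℝ ∞ (moeb g) z := by
  unfold den at hz
  rw [show moeb g = fun z => (g 0 0 * z + g 0 1) * (g 1 0 * z + g 1 1)⁻¹ from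
    funext fun z => div_eq_mul_inv _ _]
  exact ContDiffAt.mul (by fun_prop) (ContDiffAt.inv (by fun_prop) hz)

lemma contDiff_den (g : SL(2, ℂ)) : ContDiff ℝ ∞ (den g) := by
  unfold den
  fun_prop

lemma inclSL_apply (g : SL(2, ℝ)) (i j : Fin 2) : inclSL g i j = (g i j : ℂ) := rfl

/-- With $c,d$ real and not both zero, $cz+d$ can vanish only at a real $z$. -/
lemma den_inclSL_ne_zero (g : SL(2, ℝ)) {z : ℂ} (hz : z.im ≠ 0) : den (inclSL g) z ≠ 0 := by
  intro h
  have hd := det_eq (inclSL g)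
  have him := congrArg Complex.im h
  have hre := congrArg Complex.re h
  simp only [den, inclSL_apply, Complex.add_im, Complex.mul_im, Complex.ofReal_re,
    Complex.ofReal_im, Complex.add_re, Complex.mul_re, Complex.zero_im, Complex.zero_re] at him hre
  have h0 : g 1 0 = 0 := by
    refine (mul_eq_zero.1 (?_ : g 1 0 * z.im = 0)).resolve_right hz
    linarith
  have h1 : g 1 1 = 0 := by simpa [h0] using hre
  simp [inclSL_apply, h0, h1] at hd

lemma im_moeb_inclSL (g : SL(2, ℝ)) (z : ℂ) :
    (moeb (inclSL g) z).im = z.im / Complex.normSq (den (inclSL g) z) := by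
  have hd : g 0 0 * g 1 1 - g 0 1 * g 1 0 = 1 := by
    have := det_eq (inclSL g)
    simp only [inclSL_apply] at this
    exact_mod_cast this
  rw [moeb, Complex.div_im, ← sub_div]
  unfold den
  congr 1
  simp only [inclSL_apply, Complex.add_im, Complex.mul_im, Complex.ofReal_re,
    Complex.ofReal_im, Complex.add_re, Complex.mul_re]
  linear_combination z.im * hd

lemma im_moeb_inclSL_ne_zero (g : SL(2, ℝ)) {z : ℂ} (hz : z.im ≠ 0) :
    (moeb (inclSL g) z).im ≠ 0 := by
  rw [im_moeb_inclSL]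
  exact div_ne_zero hz (Complex.normSq_eq_zero.not.2 (den_inclSL_ne_zero g hz))

lemma im_moeb_inclSL_eq_zero (g : SL(2, ℝ)) {z : ℂ} (hz : z.im = 0) :
    (moeb (inclSL g) z).im = 0 := by
  rw [im_moeb_inclSL, hz, zero_div]

/-- The smooth functions with compact support in `ℂ ∖ ℝ`. -/
structure IsCore (f : ℂ → ℂ) : Prop where
  contDiff : ContDiff ℝ ∞ f
  hasCompactSupport : HasCompactSupport f
  tsupport_subset : tsupport f ⊆ {z | z.im ≠ 0}

lemma IsCore.memLp {f : ℂ → ℂ} (hf : IsCore f) : MemLp f 2 volume :=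
  hf.contDiff.continuous.memLp_of_hasCompactSupport hf.hasCompactSupport

/-- The support is carried into the image of a compact set under a map continuous off the real axis
and preserving its complement. Near the real axis the new function vanishes, so the singularity of
the weight does no harm. -/
lemma IsCore.principalSeries {f : ℂ → ℂ} (hf : IsCore f) (ℓ : ℤ) (g : SL(2, ℝ)) :
    IsCore (principalSeries (-2) ℓ (inclSL g) f) := by
  set F := StarRep.principalSeries (-2) ℓ (inclSL g) f with hF
  have hFz (z : ℂ) : F z = psWeight ℓ (den (inclSL g⁻¹) z) * f (moeb (inclSL g⁻¹) z) := by
    rw [hF, principalSeries_eq, map_inv]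
  have hcont : ContinuousOn (moeb (inclSL g)) (tsupport f) := fun z hz =>
    (contDiffAt_moeb _ (den_inclSL_ne_zero g
      (hf.tsupport_subset hz))).continuousAt.continuousWithinAt
  have hK := hf.hasCompactSupport.isCompact.image_of_continuousOn hcont
  have hsub : moeb (inclSL g) '' tsupport f ⊆ {z | z.im ≠ 0} := by
    rintro _ ⟨z, hz, rfl⟩
    exact im_moeb_inclSL_ne_zero g (hf.tsupport_subset hz)
  have hzero : ∀ z ∉ moeb (inclSL g) '' tsupport f, F z = 0 := by
    intro z hz
    rw [hFz]
    by_contra h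
    have h1 : moeb (inclSL g⁻¹) z ∈ tsupport f := subset_tsupport f (right_ne_zero_of_mul h)
    -- This covers the pole too: division by zero gives the value $0$, which is real.
    have h2 : z.im ≠ 0 := fun h0 => hf.tsupport_subset h1 (im_moeb_inclSL_eq_zero g⁻¹ h0)
    refine hz ⟨_, h1, ?_⟩
    have := moeb_inv_moeb (inclSL g⁻¹) (den_inclSL_ne_zero g⁻¹ h2)
    rwa [← map_inv, inv_inv] at this
  refine ⟨contDiff_iff_contDiffAt.2 fun z => ?_, HasCompactSupport.intro hK hzero,
    (closure_minimal (fun z hz => ?_) hK.isClosed).trans hsub⟩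
  · by_cases hz : z.im = 0
    · have h1 : ∀ᶠ y in 𝓝 z, F y = 0 := by
        filter_upwards [hK.isClosed.isOpen_compl.mem_nhds fun h => hsub h hz] with y hy
        exact hzero y hy
      exact (contDiffAt_const (c := (0 : ℂ))).congr_of_eventuallyEq h1
    · have hd := den_inclSL_ne_zero g⁻¹ hz
      rw [show F = _ from funext hFz]
      exact ((contDiffAt_psWeight ℓ hd).comp z (contDiff_den _).contDiffAt).mul
        (hf.contDiff.contDiffAt.comp z (contDiffAt_moeb _ hd))
  · by_contra h
    exact hz (hzero z h)

lemma IsCore.add {f g : ℂ → ℂ} (hf : IsCore f) (hg : IsCore g) : IsCore (f + g) where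
  contDiff := hf.contDiff.add hg.contDiff
  hasCompactSupport := hf.hasCompactSupport.add hg.hasCompactSupport
  tsupport_subset := (tsupport_add f g).trans (Set.union_subset hf.tsupport_subset
    hg.tsupport_subset)

lemma IsCore.const_smul {f : ℂ → ℂ} (hf : IsCore f) (c : ℂ) : IsCore (c • f) where
  contDiff := hf.contDiff.const_smul c
  hasCompactSupport := hf.hasCompactSupport.smul_left (f := fun _ => c)
  tsupport_subset := (closure_mono (Function.support_const_smul_subset c f)).trans
    hf.tsupport_subset

lemma isCore_zero : IsCore 0 :=
  ⟨contDiff_const, HasCompactSupport.zero, by simp [tsupport]⟩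

/-- The classes in `L²(ℂ)` of the smooth functions with compact support in `ℂ ∖ ℝ`. -/
def coreL2 : Submodule ℂ L2C where
  carrier := {F | ∃ f, IsCore f ∧ F =ᵐ[volume] f}
  add_mem' := by
    rintro F G ⟨f, hf, hF⟩ ⟨g, hg, hG⟩
    exact ⟨f + g, hf.add hg, (Lp.coeFn_add F G).trans (hF.add hG)⟩
  zero_mem' := ⟨0, isCore_zero, Lp.coeFn_zero _ _ _⟩
  smul_mem' := by
    rintro c F ⟨f, hf, hF⟩
    exact ⟨c • f, hf.const_smul c, (Lp.coeFn_smul c F).trans (hF.const_smul c)⟩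

lemma ae_im_ne_zero : ∀ᵐ z : ℂ, z.im ≠ 0 := by
  have h := Measure.addHaar_submodule (volume : Measure ℂ) (LinearMap.ker Complex.imLm) (by
    intro h
    have : Complex.I ∈ LinearMap.ker Complex.imLm := h ▸ Submodule.mem_top
    simp at this)
  filter_upwards [compl_mem_ae_iff.2 h] with z hz h0
  exact hz h0

/-- A function orthogonal to the core vanishes as a distribution on $\mathbb C\setminus\mathbb R$,
hence almost everywhere, the real axis being null. -/
lemma dense_coreL2 : Dense (coreL2 : Set L2C) := by
  rw [Submodule.dense_iff_topologicalClosure_eq_top, Submodule.topologicalClosure_eq_top_iff,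
    Submodule.eq_bot_iff]
  intro F hF
  have hU : IsOpen {z : ℂ | z.im ≠ 0} := isOpen_ne_fun Complex.continuous_im continuous_const
  have hloc : LocallyIntegrable F volume := (Lp.memLp F).locallyIntegrable one_le_two
  have h0 := hU.ae_eq_zero_of_integral_contDiff_smul_eq_zero (hloc.locallyIntegrableOn _)
    fun g hg hg' hg'' => ?_
  · refine Lp.ext ?_
    filter_upwards [h0, ae_im_ne_zero, Lp.coeFn_zero ℂ 2 volume] with z h1 h2 h3
    rw [h1 h2, h3]
    rfl
  · have hc : IsCore fun z => (g z : ℂ) :=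
      ⟨Complex.ofRealCLM.contDiff.comp hg, hg'.comp_left (g := Complex.ofReal) rfl,
        (closure_mono fun z hz => by simpa using hz).trans hg''⟩
    have h1 := (Submodule.mem_orthogonal _ _).1 hF hc.memLp.toLp ⟨_, hc, hc.memLp.coeFn_toLp⟩
    rw [L2.inner_def] at h1
    rw [← h1]
    refine integral_congr_ae ?_
    filter_upwards [hc.memLp.coeFn_toLp] with z hz
    rw [hz]
    simp [mul_comm]

/-! ### Strong continuity of the principal series -/

/-- Dominated convergence along $g\to1$ needs a countably generated neighbourhood filter. -/
instance : FirstCountableTopology SL(2, ℂ) :=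
  haveI : FirstCountableTopology (Matrix (Fin 2) (Fin 2) ℂ) :=
    inferInstanceAs (FirstCountableTopology (Fin 2 → Fin 2 → ℂ))
  Topology.IsInducing.firstCountableTopology
    Matrix.SpecialLinearGroup.isClosedEmbedding_val.isInducing

lemma tendsto_inner_psRep (ℓ : ℤ) {F : L2C} (hF : F ∈ coreL2) :
    Tendsto (fun g => inner ℂ F (psRep ℓ g⁻¹ F)) (𝓝 1) (𝓝 (inner ℂ F F)) := by
  obtain ⟨f, hf, hFf⟩ := hF
  have h1 (g : SL(2, ℂ)) : inner ℂ F (psRep ℓ g⁻¹ F)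
      = ∫ z, inner ℂ (f z) (psWeight ℓ (den g z) * f (moeb g z)) := by
    rw [L2.inner_def]
    refine integral_congr_ae ?_
    filter_upwards [hFf, coeFn_psRep ℓ g⁻¹ hFf] with z h1 h2
    rw [h1, h2, principalSeries_eq, inv_inv]
  have h2 : inner ℂ F F = ∫ z, inner ℂ (f z) (f z) := by
    rw [L2.inner_def]
    refine integral_congr_ae ?_
    filter_upwards [hFf] with z h1
    rw [h1]
  simp only [h1]
  rw [h2]
  obtain ⟨M, hM⟩ := hf.hasCompactSupport.exists_bound_of_continuous hf.contDiff.continuous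
  have hM0 : 0 ≤ M := (norm_nonneg _).trans (hM 0)
  -- The inner product only sees the compact support of $f$, where $cz+d$ is uniformly close to $1$.
  -- The weight is thus at most $4$, whence the majorant `‖f z‖ * (4 * M)`.
  have hden : ∀ᶠ g : SL(2, ℂ) in 𝓝 1, ∀ z ∈ tsupport f, 1 / 2 < ‖den g z‖ := by
    refine hf.hasCompactSupport.isCompact.eventually_forall_of_forall_eventually fun z _ => ?_
    refine (continuous_norm.comp continuous_den).continuousAt.eventually_const_lt ?_
    norm_num
  refine tendsto_integral_filter_of_dominated_convergence (fun z => ‖f z‖ * (4 * M))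
    (Eventually.of_forall fun g => ?_) ?_ ?_ (Eventually.of_forall fun z => ?_)
  · have := measurable_psWeight ℓ
    have := measurable_den g
    have := measurable_moeb g
    have := hf.contDiff.continuous.measurable
    exact (Measurable.inner (by fun_prop) (by fun_prop)).aestronglyMeasurable
  · filter_upwards [hden] with g hg
    refine Eventually.of_forall fun z => (norm_inner_le_norm _ _).trans ?_
    by_cases hz : z ∈ tsupport f
    · have h3 := hg z hz
      have h4 : den g z ≠ 0 := by
        intro h
        rw [h, norm_zero] at h3
        norm_num at h3
      rw [norm_mul, norm_psWeight ℓ h4]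
      gcongr
      · rw [inv_le_comm₀ (by positivity) (by norm_num)]
        nlinarith
      · exact hM _
    · rw [image_eq_zero_of_notMem_tsupport hz]
      simp
  · exact (hf.contDiff.continuous.integrable_of_hasCompactSupport
      hf.hasCompactSupport).norm.mul_const _
  · have hd1 : den (1 : SL(2, ℂ)) z ≠ 0 := by simp
    have hp : ContinuousAt (fun g : SL(2, ℂ) => (g, z)) 1 :=
      (Continuous.prodMk_left z).continuousAt
    have h3 : ContinuousAt (fun g : SL(2, ℂ) => psWeight ℓ (den g z)) 1 :=
      (continuousAt_psWeight ℓ hd1).comp (f := fun g => den g z)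
        (ContinuousAt.comp (g := fun p : SL(2, ℂ) × ℂ => den p.1 p.2)
          continuous_den.continuousAt hp)
    have h4 : ContinuousAt (fun g : SL(2, ℂ) => moeb g z) 1 :=
      ContinuousAt.comp (g := fun p : SL(2, ℂ) × ℂ => moeb p.1 p.2)
        (f := fun g => (g, z)) (continuousAt_moeb hd1) hp
    have h4' : ContinuousAt (fun g : SL(2, ℂ) => f (moeb g z)) 1 :=
      hf.contDiff.continuous.continuousAt.comp (f := fun g => moeb g z) h4
    have h5 := (tendsto_const_nhds (x := f z)).inner (𝕜 := ℂ) (h3.tendsto.mul h4'.tendsto)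
    simpa using h5

/-- By unitarity, convergence of the diagonal matrix coefficient already forces convergence in norm.
-/
lemma norm_psRep_sub_sq (ℓ : ℤ) (g : SL(2, ℂ)) (F : L2C) :
    ‖psRep ℓ g F - F‖ ^ 2 = 2 * (inner ℂ F F - inner ℂ F (psRep ℓ g F)).re := by
  have h := @norm_sub_sq ℂ L2C _ _ _ F (psRep ℓ g F)
  rw [norm_sub_rev, h, LinearIsometryEquiv.norm_map, Complex.sub_re]
  have h2 : (inner ℂ F F).re = ‖F‖ ^ 2 := inner_self_eq_norm_sq (𝕜 := ℂ) F
  rw [h2]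
  simp only [RCLike.re_to_complex]
  ring

lemma tendsto_psRep_of_mem_coreL2 (ℓ : ℤ) {F : L2C} (hF : F ∈ coreL2) :
    Tendsto (fun g => psRep ℓ g F) (𝓝 1) (𝓝 F) := by
  have h1 : Tendsto (fun g : SL(2, ℂ) => inner ℂ F (psRep ℓ g F)) (𝓝 1) (𝓝 (inner ℂ F F)) := by
    have h : Tendsto (fun g : SL(2, ℂ) => g⁻¹) (𝓝 1) (𝓝 1) := by
      simpa using (continuous_inv (G := SL(2, ℂ))).tendsto 1
    have h' := (tendsto_inner_psRep ℓ hF).comp h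
    simpa only [Function.comp_def, inv_inv] using h'
  rw [tendsto_iff_norm_sub_tendsto_zero]
  have h2 : Tendsto (fun g => ‖psRep ℓ g F - F‖ ^ 2) (𝓝 1) (𝓝 0) := by
    simp only [norm_psRep_sub_sq]
    have h3 := ((Complex.continuous_re.tendsto _).comp
      ((tendsto_const_nhds (x := inner ℂ F F)).sub h1)).const_mul 2
    simpa using h3
  simpa [Real.sqrt_sq (norm_nonneg _)] using h2.sqrt

lemma stronglyContinuous_psRep (ℓ : ℤ) : StronglyContinuous (psRep ℓ) := by
  have h1 (v : L2C) : Tendsto (fun g => psRep ℓ g v) (𝓝 1) (𝓝 v) := by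
    rw [Metric.tendsto_nhds]
    intro ε hε
    obtain ⟨F, hF, hFv⟩ := dense_coreL2.exists_dist_lt v (show 0 < ε / 3 by positivity)
    filter_upwards [Metric.tendsto_nhds.1 (tendsto_psRep_of_mem_coreL2 ℓ hF) (ε / 3)
      (by positivity)] with g hg
    calc dist (psRep ℓ g v) v
        ≤ dist (psRep ℓ g v) (psRep ℓ g F) + dist (psRep ℓ g F) F + dist F v :=
          dist_triangle4 _ _ _ _
      _ < ε / 3 + ε / 3 + ε / 3 := by
          rw [LinearIsometryEquiv.dist_map, dist_comm F v]
          gcongr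
      _ = ε := by ring
  intro v
  refine continuous_iff_continuousAt.2 fun g₀ => ?_
  have h2 : (fun g => psRep ℓ g v) = fun g => psRep ℓ g₀ (psRep ℓ (g₀⁻¹ * g) v) := by
    ext1 g
    rw [← psRep_mul_apply, mul_inv_cancel_left]
  have h3 : Tendsto (fun g => g₀⁻¹ * g) (𝓝 g₀) (𝓝 1) := by
    simpa using (continuous_const_mul g₀⁻¹).tendsto g₀
  rw [ContinuousAt, h2]
  exact ((psRep ℓ g₀).continuous.tendsto v).comp ((h1 v).comp h3)

end Core

/-! ### The infinitesimal principal series -/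

section Infinitesimal

open scoped ContDiff Topology ENNReal Interval
open Filter

lemma expSL_add_smul (X : sl2) (s t : ℝ) :
    expSL ((s + t) • X) = expSL (s • X) * expSL (t • X) := by
  refine Subtype.ext ?_
  change NormedSpace.exp ((s + t) • (X : Matrix (Fin 2) (Fin 2) ℝ)) = NormedSpace.exp (s • X.1) *
    NormedSpace.exp (t • X.1)
  rw [add_smul, Matrix.exp_add_of_commute]
  exact ((Commute.refl _).smul_left s).smul_right t

lemma expSL_zero_smul (X : sl2) : expSL ((0 : ℝ) • X) = 1 := by
  refine Subtype.ext ?_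
  change NormedSpace.exp ((0 : ℝ) • (X : Matrix (Fin 2) (Fin 2) ℝ)) = 1
  rw [zero_smul, NormedSpace.exp_zero]

lemma expSL_neg_smul (X : sl2) (s : ℝ) : expSL ((-s) • X) = (expSL (s • X))⁻¹ := by
  rw [eq_inv_iff_mul_eq_one, ← expSL_add_smul, neg_add_cancel, expSL_zero_smul]

attribute [local instance] Matrix.linftyOpNormedRing Matrix.linftyOpNormedAlgebra in
lemma continuous_expSL_smul (X : sl2) : Continuous fun s : ℝ => expSL (s • X) := by
  refine Continuous.subtype_mk ?_ _
  exact (NormedSpace.exp_continuous (𝔸 := Matrix (Fin 2) (Fin 2) ℝ)).comp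
    (continuous_id.smul continuous_const)

attribute [local instance] Matrix.linftyOpNormedRing Matrix.linftyOpNormedAlgebra in
lemma hasDerivAt_expSL_apply (X : sl2) (i j : Fin 2) :
    HasDerivAt (fun s : ℝ => (expSL (s • X)) i j) (X.1 i j) 0 := by
  have h := hasDerivAt_exp_smul_const (𝕂 := ℝ) X.1 0
  have h1 := (LinearMap.toContinuousLinearMap
    (Matrix.entryLinearMap ℝ ℝ i j)).hasFDerivAt.comp_hasDerivAt (0 : ℝ) h
  refine h1.congr_deriv ?_
  rw [zero_smul, NormedSpace.exp_zero, one_mul]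
  rfl

lemma hasDerivAt_inclSL_inv_apply (X : sl2) (i j : Fin 2) :
    HasDerivAt (fun s : ℝ => (inclSL (expSL (s • X)))⁻¹ i j) (-(X.1 i j : ℂ)) 0 := by
  have h1 : HasDerivAt (fun s : ℝ => (expSL (s • X)) i j) (X.1 i j) (-0) := by
    rw [neg_zero]
    exact hasDerivAt_expSL_apply X i j
  have h : HasDerivAt (fun s : ℝ => (expSL ((-s) • X)) i j) (-(X.1 i j)) 0 :=
    (h1.scomp 0 (hasDerivAt_neg (0 : ℝ))).congr_deriv (by simp)
  simp only [← map_inv, ← expSL_neg_smul]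
  exact h.ofReal_comp.congr_deriv (Complex.ofReal_neg _)

/-- The infinitesimal action of `sl(2, ℝ)` in the principal series `𝒫^{-2,ℓ}`. -/
def psDeriv (ℓ : ℤ) (X : sl2) (f : ℂ → ℂ) (z : ℂ) : ℂ :=
  fderiv ℝ f z (X.1 1 0 * z ^ 2 - 2 * X.1 0 0 * z - X.1 0 1)
    + (2 * (X.1 1 0 * z.re - X.1 0 0) - Complex.I * ℓ * (X.1 1 0 * z.im)) * f z

/-- At the point $1$ the modulus varies with the real part of the velocity and the phase with its
imaginary part. -/
lemma hasDerivAt_psWeight (ℓ : ℤ) {D : ℝ → ℂ} {D' : ℂ} (hD : HasDerivAt D D' 0) (hD0 : D 0 = 1) :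
    HasDerivAt (fun s => psWeight ℓ (D s)) (-2 * D'.re + Complex.I * ℓ * D'.im) 0 := by
  have hn : HasDerivAt (fun s => ‖D s‖) D'.re 0 := by
    have h1 := hD.norm_sq.sqrt (by simp [hD0])
    simp only [Real.sqrt_sq (norm_nonneg _), hD0] at h1
    refine h1.congr_deriv ?_
    simp [Complex.inner]
  have hn' := hn.ofReal_comp
  have hq : HasDerivAt (fun s => D s / (‖D s‖ : ℂ)) (Complex.I * D'.im) 0 := by
    refine (hD.div hn' (by simp [hD0])).congr_deriv ?_
    simp only [hD0]
    apply Complex.ext <;> simp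
  have hz : HasDerivAt (fun s => (D s / (‖D s‖ : ℂ)) ^ ℓ) (ℓ * (Complex.I * D'.im)) 0 := by
    have h1 := hasDerivAt_zpow ℓ (D 0 / (‖D 0‖ : ℂ)) (Or.inl (by simp [hD0]))
    have h2 := HasDerivAt.scomp (h := fun s => D s / (‖D s‖ : ℂ)) (0 : ℝ) h1 hq
    refine h2.congr_deriv ?_
    simp [hD0]
    ring
  simp only [psWeight_eq]
  refine (((hn'.pow 2).fun_inv (by simp [hD0])).mul hz).congr_deriv ?_
  simp [hD0]
  ring

lemma hasDerivAt_principalSeries_zero (ℓ : ℤ) (X : sl2) {f : ℂ → ℂ} {z : ℂ}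
    (hf : DifferentiableAt ℝ f z) :
    HasDerivAt (fun s : ℝ => principalSeries (-2) ℓ (inclSL (expSL (s • X))) f z)
      (psDeriv ℓ X f z) 0 := by
  have h0 : (inclSL (expSL ((0 : ℝ) • X)))⁻¹ = 1 := by
    rw [expSL_zero_smul, map_one, inv_one]
  have hD : HasDerivAt (fun s : ℝ => den (inclSL (expSL (s • X)))⁻¹ z)
      (-(X.1 1 0) * z - X.1 1 1) 0 :=
    ((hasDerivAt_inclSL_inv_apply X 1 0).mul_const z).add (hasDerivAt_inclSL_inv_apply X 1 1)
  have hN : HasDerivAt (fun s : ℝ => (inclSL (expSL (s • X)))⁻¹ 0 0 * z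
      + (inclSL (expSL (s • X)))⁻¹ 0 1) (-(X.1 0 0) * z - X.1 0 1) 0 :=
    ((hasDerivAt_inclSL_inv_apply X 0 0).mul_const z).add (hasDerivAt_inclSL_inv_apply X 0 1)
  have hD0 : den (inclSL (expSL ((0 : ℝ) • X)))⁻¹ z = 1 := by rw [h0, den_one]
  have hm0 : moeb (inclSL (expSL ((0 : ℝ) • X)))⁻¹ z = z := by rw [h0, moeb_one]
  have hm : HasDerivAt (fun s : ℝ => moeb (inclSL (expSL (s • X)))⁻¹ z)
      (X.1 1 0 * z ^ 2 - 2 * X.1 0 0 * z - X.1 0 1) 0 := by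
    refine (hN.div hD (by rw [hD0]; exact one_ne_zero)).congr_deriv ?_
    rw [hD0, h0]
    simp [sl2_apply_one_one]
    ring
  have hfm : HasDerivAt (fun s : ℝ => f (moeb (inclSL (expSL (s • X)))⁻¹ z)) _ 0 :=
    HasFDerivAt.comp_hasDerivAt (f := fun s : ℝ => moeb (inclSL (expSL (s • X)))⁻¹ z) (0 : ℝ)
      (l := f) (by rw [hm0]; exact hf.hasFDerivAt) hm
  simp only [principalSeries_eq]
  refine ((hasDerivAt_psWeight ℓ hD hD0).mul hfm).congr_deriv ?_
  rw [hm0, hD0, psWeight_one, psDeriv]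
  simp [sl2_apply_one_one]
  ring

/-- The group law moves the derivative at time $s$ to time $0$, at the transported point; no pole is
met since $z$ is not real. -/
lemma hasDerivAt_principalSeries (ℓ : ℤ) (X : sl2) {f : ℂ → ℂ} (hf : Differentiable ℝ f) {z : ℂ}
    (hz : z.im ≠ 0) (s : ℝ) :
    HasDerivAt (fun s : ℝ => principalSeries (-2) ℓ (inclSL (expSL (s • X))) f z)
      (principalSeries (-2) ℓ (inclSL (expSL (s • X))) (psDeriv ℓ X f) z) s := by
  have hd (g : SL(2, ℝ)) : den (inclSL g)⁻¹ z ≠ 0 := by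
    rw [← map_inv]
    exact den_inclSL_ne_zero g⁻¹ hz
  have h (t : ℝ) : principalSeries (-2) ℓ (inclSL (expSL (t • X))) f z =
      psWeight ℓ (den (inclSL (expSL (s • X)))⁻¹ z) *
        principalSeries (-2) ℓ (inclSL (expSL ((t - s) • X))) f
          (moeb (inclSL (expSL (s • X)))⁻¹ z) := by
    rw [← principalSeries_eq, ← principalSeries_mul ℓ _ _ f (hd _) (by rw [← map_mul]; exact hd _),
      ← map_mul, ← expSL_add_smul, add_sub_cancel]
  simp only [h]
  have h1 := hasDerivAt_principalSeries_zero ℓ X (hf (moeb (inclSL (expSL (s • X)))⁻¹ z))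
  rw [← sub_self s] at h1
  exact (h1.comp_sub_const s s).const_mul _

lemma continuousAt_psWeight_mul_comp (ℓ : ℤ) {k : ℂ → ℂ} (hk : Continuous k) {z : ℂ}
    {c : ℝ → SL(2, ℂ)} (hc : Continuous c) {s : ℝ} (hd : den (c s) z ≠ 0) :
    ContinuousAt (fun s => psWeight ℓ (den (c s) z) * k (moeb (c s) z)) s := by
  have hp : ContinuousAt (fun s : ℝ => (c s, z)) s := (hc.prodMk continuous_const).continuousAt
  have h1 : ContinuousAt (fun s : ℝ => psWeight ℓ (den (c s) z)) s :=
    (continuousAt_psWeight ℓ hd).comp (f := fun s : ℝ => den (c s) z)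
      (ContinuousAt.comp (g := fun p : SL(2, ℂ) × ℂ => den p.1 p.2)
        continuous_den.continuousAt hp)
  have h2 : ContinuousAt (fun s : ℝ => moeb (c s) z) s :=
    ContinuousAt.comp (g := fun p : SL(2, ℂ) × ℂ => moeb p.1 p.2)
      (f := fun s : ℝ => (c s, z)) (continuousAt_moeb hd) hp
  exact h1.mul (hk.continuousAt.comp (f := fun s : ℝ => moeb (c s) z) h2)

lemma continuous_inclSL_expSL (X : sl2) : Continuous fun s : ℝ => inclSL (expSL (s • X)) :=
  (Complex.continuous_ofReal.specialLinearGroup_map (f := algebraMap ℝ ℂ)).comp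
    (continuous_expSL_smul X)

lemma continuous_principalSeries (ℓ : ℤ) (X : sl2) {k : ℂ → ℂ} (hk : Continuous k) {z : ℂ}
    (hz : z.im ≠ 0) :
    Continuous fun s : ℝ => principalSeries (-2) ℓ (inclSL (expSL (s • X))) k z := by
  refine continuous_iff_continuousAt.2 fun s =>
    continuousAt_psWeight_mul_comp ℓ hk (continuous_inclSL_expSL X).inv ?_
  rw [Pi.inv_apply, ← map_inv]
  exact den_inclSL_ne_zero _ hz

lemma measurable_principalSeries (ℓ : ℤ) (X : sl2) {k : ℂ → ℂ} (hk : Continuous k) :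
    Measurable fun p : ℝ × ℂ => principalSeries (-2) ℓ (inclSL (expSL (p.1 • X))) k p.2 := by
  have hm (i j : Fin 2) : Measurable fun p : ℝ × ℂ => (inclSL (expSL (p.1 • X)))⁻¹ i j :=
    ((continuous_apply j).comp (Matrix.SpecialLinearGroup.continuous_apply _
      ((continuous_inclSL_expSL X).inv.comp continuous_fst) i)).measurable
  have h1 := measurable_psWeight ℓ
  have h2 := hk.measurable
  simp only [principalSeries_eq, den, moeb]
  have := hm 0 0
  have := hm 0 1
  have := hm 1 0
  have := hm 1 1
  fun_prop

lemma principalSeries_one (ℓ : ℤ) (f : ℂ → ℂ) (z : ℂ) : principalSeries (-2) ℓ 1 f z = f z := by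
  simp [principalSeries_eq]

lemma principalSeries_sub_eq_integral (ℓ : ℤ) (X : sl2) {f : ℂ → ℂ} (hf : Differentiable ℝ f)
    (hk : Continuous (psDeriv ℓ X f)) {z : ℂ} (hz : z.im ≠ 0) (t : ℝ) :
    principalSeries (-2) ℓ (inclSL (expSL (t • X))) f z - f z - t * psDeriv ℓ X f z =
      ∫ s in 0..t, (principalSeries (-2) ℓ (inclSL (expSL (s • X))) (psDeriv ℓ X f) z
        - psDeriv ℓ X f z) := by
  have hc := continuous_principalSeries ℓ X hk hz
  rw [intervalIntegral.integral_sub (hc.intervalIntegrable _ _) intervalIntegrable_const,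
    intervalIntegral.integral_eq_sub_of_hasDerivAt
      (fun s _ => hasDerivAt_principalSeries ℓ X hf hz s) (hc.intervalIntegrable _ _),
    intervalIntegral.integral_const, expSL_zero_smul, map_one, principalSeries_one]
  simp

lemma eLpNorm_two_sq {α : Type*} [MeasurableSpace α] (μ : Measure α) (f : α → ℂ) :
    eLpNorm f 2 μ ^ 2 = ∫⁻ x, ‖f x‖ₑ ^ 2 ∂μ := by
  have h := eLpNorm_nnreal_pow_eq_lintegral (μ := μ) (f := f) (p := 2) two_ne_zero
  simpa using h

lemma enorm_intervalIntegral_sq_le {q : ℝ → ℂ} (hq : Measurable q) (t : ℝ) :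
    ‖∫ s in 0..t, q s‖ₑ ^ 2 ≤ ENNReal.ofReal |t| * ∫⁻ s in Ι 0 t, ‖q s‖ₑ ^ 2 := by
  have h1 : ‖∫ s in 0..t, q s‖ₑ = ‖∫ s in Ι 0 t, q s‖ₑ := by
    rw [← ofReal_norm, ← ofReal_norm, intervalIntegral.norm_intervalIntegral_eq]
  have h2 : ‖∫ s in Ι 0 t, q s‖ₑ ≤ eLpNorm q 1 (volume.restrict (Ι 0 t)) :=
    (enorm_integral_le_lintegral_enorm q).trans_eq eLpNorm_one_eq_lintegral_enorm.symm
  have h3 := eLpNorm_le_eLpNorm_mul_rpow_measure_univ (p := 1) (q := 2) one_le_two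
    (hq.aestronglyMeasurable (μ := volume.restrict (Ι 0 t)))
  rw [h1, ← eLpNorm_two_sq]
  refine (pow_le_pow_left' (h2.trans h3) 2).trans_eq ?_
  rw [mul_pow, mul_comm, ← ENNReal.rpow_natCast (_ ^ _), ← ENNReal.rpow_mul,
    Measure.restrict_apply_univ, Real.volume_uIoc]
  norm_num

/-- A form of Minkowski's integral inequality, from Cauchy–Schwarz in $s$ and Tonelli. -/
lemma eLpNorm_intervalIntegral_le {q : ℝ × ℂ → ℂ} (hq : Measurable q) {t : ℝ} {ε : ℝ≥0∞}
    (hε : ∀ s ∈ Ι 0 t, eLpNorm (fun z => q (s, z)) 2 volume ≤ ε) :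
    eLpNorm (fun z => ∫ s in 0..t, q (s, z)) 2 volume ≤ ENNReal.ofReal |t| * ε := by
  rw [← ENNReal.pow_le_pow_left_iff two_ne_zero, eLpNorm_two_sq]
  calc ∫⁻ z, ‖∫ s in 0..t, q (s, z)‖ₑ ^ 2
      ≤ ∫⁻ z, ENNReal.ofReal |t| * ∫⁻ s in Ι 0 t, ‖q (s, z)‖ₑ ^ 2 :=
        lintegral_mono fun z => enorm_intervalIntegral_sq_le (hq.comp measurable_prodMk_right) t
    _ = ENNReal.ofReal |t| * ∫⁻ s in Ι 0 t, ∫⁻ z, ‖q (s, z)‖ₑ ^ 2 := by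
        rw [lintegral_const_mul', lintegral_lintegral_swap]
        · exact ((hq.comp measurable_swap).enorm.pow_const 2).aemeasurable
        · exact ENNReal.ofReal_ne_top
    _ ≤ ENNReal.ofReal |t| * ∫⁻ _ in Ι 0 t, ε ^ 2 := by
        gcongr ENNReal.ofReal |t| * ?_
        refine setLIntegral_mono' measurableSet_uIoc fun s hs => ?_
        rw [← eLpNorm_two_sq]
        exact pow_le_pow_left' (hε s hs) 2
    _ = (ENNReal.ofReal |t| * ε) ^ 2 := by
        rw [setLIntegral_const, Real.volume_uIoc, sub_zero]
        ring

/-- The first-order remainder is, off the real axis, the integral over $[0,t]$ of $\mathcal P(\exp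
sX)k-k$ with $k$ the pointwise derivative. Strong continuity at $k$ makes its norm $o(t)$. This
needs no invariant domain, only that $f$ and $k$ represent $L^2$ classes. -/
lemma hasDerivAt_psRep (ℓ : ℤ) (X : sl2) {f : ℂ → ℂ} (hf : Differentiable ℝ f)
    (hk : Continuous (psDeriv ℓ X f)) {F K : L2C} (hF : F =ᵐ[volume] f)
    (hK : K =ᵐ[volume] psDeriv ℓ X f) :
    HasDerivAt (fun t : ℝ => psRep ℓ (inclSL (expSL (t • X))) F) K 0 := by
  set k := psDeriv ℓ X f with hk_def
  set q : ℝ × ℂ → ℂ := fun p =>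
    principalSeries (-2) ℓ (inclSL (expSL (p.1 • X))) k p.2 - k p.2 with hq_def
  have hq : Measurable q :=
    (measurable_principalSeries ℓ X hk).sub (hk.measurable.comp measurable_snd)
  have hqs (s : ℝ) : eLpNorm (fun z => q (s, z)) 2 volume
      = ‖psRep ℓ (inclSL (expSL (s • X))) K - K‖ₑ := by
    rw [Lp.enorm_def]
    refine eLpNorm_congr_ae ?_
    filter_upwards [hK, coeFn_psRep ℓ (inclSL (expSL (s • X))) hK,
      Lp.coeFn_sub (psRep ℓ (inclSL (expSL (s • X))) K) K] with z h1 h2 h3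
    rw [h3, Pi.sub_apply, h2, h1]
  rw [hasDerivAt_iff_isLittleO_nhds_zero, Asymptotics.isLittleO_iff]
  intro c hc
  have hcont : Tendsto (fun s : ℝ => psRep ℓ (inclSL (expSL (s • X))) K - K) (𝓝 0) (𝓝 0) := by
    have h1 : Continuous fun s : ℝ => psRep ℓ (inclSL (expSL (s • X))) K - K :=
      ((stronglyContinuous_psRep ℓ K).comp (continuous_inclSL_expSL X)).sub continuous_const
    have h2 := h1.tendsto 0
    rwa [expSL_zero_smul, map_one, psRep_one_apply, sub_self] at h2
  obtain ⟨δ, hδ, hball⟩ := Metric.eventually_nhds_iff.1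
    (hcont.eventually (Metric.closedBall_mem_nhds 0 hc))
  filter_upwards [Metric.ball_mem_nhds (0 : ℝ) hδ] with t ht
  have hle : ∀ s ∈ Ι 0 t, eLpNorm (fun z => q (s, z)) 2 volume ≤ ENNReal.ofReal c := by
    intro s hs
    rw [hqs, ← ofReal_norm]
    refine ENNReal.ofReal_le_ofReal ?_
    have h1 : |s| ≤ |t| := by
      have := Set.abs_sub_left_of_mem_uIcc (Set.uIoc_subset_uIcc hs)
      simpa using this
    have h2 := hball (show dist s 0 < δ by
      rw [Real.dist_eq, sub_zero]
      rw [Metric.mem_ball, Real.dist_eq, sub_zero] at ht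
      exact h1.trans_lt ht)
    simpa using h2
  have key := eLpNorm_intervalIntegral_le hq hle
  have heq : ‖psRep ℓ (inclSL (expSL ((0 + t) • X))) F
      - psRep ℓ (inclSL (expSL ((0 : ℝ) • X))) F - t • K‖ₑ
      = eLpNorm (fun z => ∫ s in 0..t, q (s, z)) 2 volume := by
    rw [Lp.enorm_def, zero_add, expSL_zero_smul, map_one, psRep_one_apply]
    refine eLpNorm_congr_ae ?_
    filter_upwards [hF, hK, coeFn_psRep ℓ (inclSL (expSL (t • X))) hF,
      Lp.coeFn_sub (psRep ℓ (inclSL (expSL (t • X))) F - F) (t • K),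
      Lp.coeFn_sub (psRep ℓ (inclSL (expSL (t • X))) F) F, Lp.coeFn_smul t K, ae_im_ne_zero]
      with z h1 h2 h3 h4 h5 h6 h7
    rw [h4, Pi.sub_apply, h5, Pi.sub_apply, h6, Pi.smul_apply, h3, h1, h2, hq_def,
      ← principalSeries_sub_eq_integral ℓ X hf hk h7 t, Complex.real_smul]
  rw [← heq, ← ofReal_norm, ← ENNReal.ofReal_mul (abs_nonneg _),
    ENNReal.ofReal_le_ofReal_iff (by positivity)] at key
  rw [Real.norm_eq_abs, mul_comm]
  exact key

end Infinitesimal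

/-! ### The intertwining operator -/

section Intertwiner

open scoped ContDiff Topology ENNReal FourierTransform
open Filter hiding pi
open Real (pi)

/-- The identification `(l, ξ) ↦ l + i a ξ` of the plane with `ℂ`, backwards. -/
def planeEquiv {a : ℝ} (ha : a ≠ 0) : ℂ ≃L[ℝ] ℝ × ℝ :=
  Complex.equivRealProdCLM.trans
    ((ContinuousLinearEquiv.refl ℝ ℝ).prodCongr
      (ContinuousLinearEquiv.unitsEquivAut ℝ (Units.mk0 a⁻¹ (inv_ne_zero ha))))

lemma planeEquiv_apply {a : ℝ} (ha : a ≠ 0) (z : ℂ) : planeEquiv ha z = (z.re, z.im / a) := by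
  simp [planeEquiv, div_eq_mul_inv]

/-- The weight making the identification of the plane with `ℂ` isometric on `L²`. -/
def planeWeight (a : ℝ) : ℂ := ((√|a|)⁻¹ : ℝ)

lemma planeWeight_ne_zero {a : ℝ} (ha : a ≠ 0) : planeWeight a ≠ 0 := by
  rw [planeWeight, Complex.ofReal_ne_zero]
  positivity

lemma lintegral_div {a : ℝ} (ha : a ≠ 0) {f : ℝ → ℝ≥0∞} (hf : Measurable f) :
    ∫⁻ y, f (y / a) = ENNReal.ofReal |a| * ∫⁻ y, f y := by
  have h := Real.map_volume_mul_right (inv_ne_zero ha)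
  rw [inv_inv] at h
  have h2 := lintegral_map (μ := volume) hf (measurable_id.mul_const a⁻¹)
  simp only [id] at h2
  rw [h, lintegral_smul_measure] at h2
  simpa [div_eq_mul_inv] using h2.symm

lemma isIsometricWeight_plane {a : ℝ} (ha : a ≠ 0) :
    IsIsometricWeight volume volume (fun _ => planeWeight a) (planeEquiv ha) where
  measurable_weight := measurable_const
  measurable_map := (planeEquiv ha).continuous.measurable
  ne_zero := Eventually.of_forall fun _ => planeWeight_ne_zero ha
  lintegral_eq f hf := by
    have h1 : ∫⁻ z : ℂ, f (planeEquiv ha z) = ENNReal.ofReal |a| * ∫⁻ y, f y := by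
      calc ∫⁻ z : ℂ, f (planeEquiv ha z)
          = ∫⁻ z : ℂ, (fun p : ℝ × ℝ => f (p.1, p.2 / a)) (Complex.measurableEquivRealProd z) := by
            simp only [planeEquiv_apply, Complex.measurableEquivRealProd_apply]
        _ = ∫⁻ p : ℝ × ℝ, f (p.1, p.2 / a) :=
            Complex.volume_preserving_equiv_real_prod.lintegral_comp_emb
              Complex.measurableEquivRealProd.measurableEmbedding
              (fun p : ℝ × ℝ => f (p.1, p.2 / a))
        _ = ∫⁻ x : ℝ, ∫⁻ y : ℝ, f (x, y / a) := by
            rw [Measure.volume_eq_prod, lintegral_prod]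
            exact Measurable.aemeasurable (by fun_prop)
        _ = ∫⁻ x : ℝ, ENNReal.ofReal |a| * ∫⁻ y : ℝ, f (x, y) :=
            lintegral_congr fun x => lintegral_div ha (f := fun y => f (x, y)) (by fun_prop)
        _ = ENNReal.ofReal |a| * ∫⁻ y, f y := by
            rw [lintegral_const_mul' _ _ ENNReal.ofReal_ne_top, Measure.volume_eq_prod,
              lintegral_prod _ hf.aemeasurable]
    have h2 : ‖planeWeight a‖ₑ ^ 2 * ENNReal.ofReal |a| = 1 := by
      rw [planeWeight, ← ofReal_norm, ← ENNReal.ofReal_pow (norm_nonneg _),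
        ← ENNReal.ofReal_mul (by positivity), Complex.norm_real, Real.norm_eq_abs, sq_abs, inv_pow,
        Real.sq_sqrt (abs_nonneg a), inv_mul_cancel₀ (abs_ne_zero.2 ha), ENNReal.ofReal_one]
    rw [lintegral_const_mul' _ _ (by finiteness), h1, ← mul_assoc, h2, one_mul]

/-- The partial Fourier transform, normalized to an isometry from `L²(ℝ²)` to `L²(ℂ)`. -/
def normFourier {a : ℝ} (ha : a ≠ 0) : L2Plane →ₗᵢ[ℂ] L2C :=
  (weightedComp (isIsometricWeight_plane ha)).comp fourierSndL2.toLinearIsometry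

lemma normFourier_toLp {a : ℝ} (ha : a ≠ 0) (u : 𝓢(ℝ × ℝ, ℂ)) :
    normFourier ha (u.toLp 2 volume) =ᵐ[volume]
      fun z => planeWeight a * fourierSnd u (planeEquiv ha z) := by
  change weightedComp (isIsometricWeight_plane ha) (fourierSndL2 (u.toLp 2 volume)) =ᵐ[volume] _
  rw [fourierSndL2_toLp]
  exact coeFn_weightedComp_of_ae_eq _ ((fourierSndS u).coeFn_toLp 2 volume)

/-- Core functions are Schwartz, and the partial transform is bijective on Schwartz space. This
serves both surjectivity of the transform and the uniqueness argument. -/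
lemma exists_normFourier_eq {a : ℝ} (ha : a ≠ 0) {F : L2C} (hF : F ∈ coreL2) :
    ∃ u : 𝓢(ℝ × ℝ, ℂ), normFourier ha (u.toLp 2 volume) = F := by
  obtain ⟨f, hf, hFf⟩ := hF
  refine ⟨fourierSndEquiv.symm ((planeWeight a)⁻¹ •
    SchwartzMap.compCLMOfContinuousLinearEquiv ℂ (planeEquiv ha).symm
      (hf.hasCompactSupport.toSchwartzMap hf.contDiff)), Lp.ext ?_⟩
  filter_upwards [normFourier_toLp ha (fourierSndEquiv.symm ((planeWeight a)⁻¹ •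
    SchwartzMap.compCLMOfContinuousLinearEquiv ℂ (planeEquiv ha).symm
      (hf.hasCompactSupport.toSchwartzMap hf.contDiff))), hFf] with z h1 h2
  rw [h1, h2, ← fourierSndS_apply]
  change _ * fourierSndEquiv (fourierSndEquiv.symm _) _ = _
  rw [LinearEquiv.apply_symm_apply]
  simp [mul_inv_cancel_left₀ (planeWeight_ne_zero ha)]

lemma surjective_normFourier {a : ℝ} (ha : a ≠ 0) : Function.Surjective (normFourier ha) := by
  have hcl : IsClosed (Set.range (normFourier ha)) :=
    (normFourier ha).isometry.isClosedEmbedding.isClosed_range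
  have hd : Dense (Set.range (normFourier ha)) := dense_coreL2.mono fun F hF => by
    obtain ⟨u, hu⟩ := exists_normFourier_eq ha hF
    exact ⟨_, hu⟩
  exact Set.range_eq_univ.1 (hcl.closure_eq.symm.trans hd.closure_eq)

/-- The normalized partial Fourier transform as a unitary operator. -/
def unitaryFourier {a : ℝ} (ha : a ≠ 0) : L2Plane ≃ₗᵢ[ℂ] L2C :=
  LinearIsometryEquiv.ofSurjective (normFourier ha) (surjective_normFourier ha)

lemma unitaryFourier_apply {a : ℝ} (ha : a ≠ 0) (u : L2Plane) :
    unitaryFourier ha u = normFourier ha u := rfl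

/-- The partial Fourier transform as an isomorphism from `L²(ℝ²)` to `L²(ℂ)`. -/
def fourierIso {a : ℝ} (ha : a ≠ 0) : L2Plane ≃L[ℂ] L2C :=
  (unitaryFourier ha).toContinuousLinearEquiv.trans
    (ContinuousLinearEquiv.smulLeft (Units.mk0 (planeWeight a)⁻¹
      (inv_ne_zero (planeWeight_ne_zero ha))))

lemma fourierIso_apply {a : ℝ} (ha : a ≠ 0) (u : L2Plane) :
    fourierIso ha u = (planeWeight a)⁻¹ • unitaryFourier ha u := rfl

/-- The scale $2\pi\nu$ arises because `fourierSnd` has kernel $e^{-2\pi i\xi l'}$: with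
$\eta=2\pi\xi$ one has $\nu\eta=2\pi\nu\,\xi$. -/
lemma isPartialFourier_fourierIso {ν : ℝ} (ha : 2 * pi * ν ≠ 0) :
    IsPartialFourier ν (fourierIso ha) := by
  intro u
  rw [fourierIso_apply, unitaryFourier_apply]
  filter_upwards [Lp.coeFn_smul (planeWeight (2 * pi * ν))⁻¹ (normFourier ha (u.toLp 2 volume)),
    normFourier_toLp ha u] with z h1 h2
  rw [h1, Pi.smul_apply, h2, smul_eq_mul, inv_mul_cancel_left₀ (planeWeight_ne_zero ha),
    partialFourier_eq, planeEquiv_apply]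
  congr 2
  rw [div_div]
  ring

/-! ### The star representation -/

/-- The star representation of `SL(2, ℝ)`. -/
def starRep (ℓ : ℤ) {a : ℝ} (ha : a ≠ 0) : SL(2, ℝ) →* (L2Plane ≃ₗᵢ[ℂ] L2Plane) where
  toFun g := (unitaryFourier ha).trans ((psRep ℓ (inclSL g)).trans (unitaryFourier ha).symm)
  map_one' := LinearIsometryEquiv.ext fun u => by
    change (unitaryFourier ha).symm (psRep ℓ (inclSL 1) (unitaryFourier ha u)) = u
    rw [map_one, psRep_one_apply, LinearIsometryEquiv.symm_apply_apply]
  map_mul' g h := LinearIsometryEquiv.ext fun u => by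
    change (unitaryFourier ha).symm (psRep ℓ (inclSL (g * h)) (unitaryFourier ha u)) =
      (unitaryFourier ha).symm (psRep ℓ (inclSL g) (unitaryFourier ha
        ((unitaryFourier ha).symm (psRep ℓ (inclSL h) (unitaryFourier ha u)))))
    rw [LinearIsometryEquiv.apply_symm_apply, map_mul, psRep_mul_apply]

lemma unitaryFourier_starRep (ℓ : ℤ) {a : ℝ} (ha : a ≠ 0) (g : SL(2, ℝ)) (u : L2Plane) :
    unitaryFourier ha (starRep ℓ ha g u) = psRep ℓ (inclSL g) (unitaryFourier ha u) :=
  LinearIsometryEquiv.apply_symm_apply _ _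

lemma starRep_apply (ℓ : ℤ) {a : ℝ} (ha : a ≠ 0) (g : SL(2, ℝ)) (u : L2Plane) :
    starRep ℓ ha g u = (unitaryFourier ha).symm (psRep ℓ (inclSL g) (unitaryFourier ha u)) := rfl

lemma fourierIso_starRep (ℓ : ℤ) {a : ℝ} (ha : a ≠ 0) (g : SL(2, ℝ)) (u : L2Plane) :
    fourierIso ha (starRep ℓ ha g u) = psRep ℓ (inclSL g) (fourierIso ha u) := by
  rw [fourierIso_apply, fourierIso_apply, unitaryFourier_starRep, map_smul]

lemma stronglyContinuous_starRep (ℓ : ℤ) {a : ℝ} (ha : a ≠ 0) :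
    StronglyContinuous (starRep ℓ ha) := fun u =>
  (unitaryFourier ha).symm.continuous.comp ((stronglyContinuous_psRep ℓ (unitaryFourier ha u)).comp
    (Complex.continuous_ofReal.specialLinearGroup_map (f := algebraMap ℝ ℂ)))

lemma pdS_comm (u : 𝓢(ℝ × ℝ, ℂ)) (i j : Fin 2) : pdS i (pdS j u) = pdS j (pdS i u) := by
  have h (i j : Fin 2) (x : ℝ × ℝ) : pdS i (pdS j u) x =
      fderiv ℝ (fderiv ℝ u) x (![((1 : ℝ), (0 : ℝ)), ((0 : ℝ), (1 : ℝ))] i)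
        (![((1 : ℝ), (0 : ℝ)), ((0 : ℝ), (1 : ℝ))] j) := by
    have h1 : HasFDerivAt (fderiv ℝ u) (fderiv ℝ (fderiv ℝ u) x) x :=
      (SchwartzMap.fderivCLM ℝ (ℝ × ℝ) ℂ u).hasFDerivAt x
    have h2 : HasFDerivAt (pdS j u) _ x := h1.clm_apply (hasFDerivAt_const _ x)
    rw [pdS_apply, h2.fderiv]
    simp
  ext x
  rw [h, h]
  exact ((u.smooth 2).contDiffAt.isSymmSndFDerivAt (by simp)).eq _ _

lemma pdS_one_mulSnd (u : 𝓢(ℝ × ℝ, ℂ)) : pdS 1 (mulSnd u) = u + mulSnd (pdS 1 u) := by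
  ext x
  have h : HasFDerivAt (fun y : ℝ × ℝ => y.2 • u y) _ x :=
    (hasFDerivAt_snd (𝕜 := ℝ) (p := x)).smul (u.hasFDerivAt x)
  rw [pdS_apply, show ⇑(mulSnd u) = _ from funext (mulSnd_apply u), h.fderiv]
  simp [pdS_apply, add_comm]

/-- The infinitesimal star representation on Schwartz functions. -/
def adStarS (ν : ℝ) (X : sl2) (u : 𝓢(ℝ × ℝ, ℂ)) : 𝓢(ℝ × ℝ, ℂ) :=
  (X.1 0 0 : ℂ) • ((2 : ℂ) • (pdS 1 (mulSnd u) - u) - (2 : ℂ) • mulFst (pdS 0 u))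
  - (X.1 0 1 : ℂ) • pdS 0 u
  + (X.1 1 0 : ℂ) • (mulFst (mulFst (pdS 0 u)) - pdS 1 u
    - (2 : ℂ) • mulFst (pdS 1 (mulSnd u) - u) + ((ν : ℂ) ^ 2) • pdS 1 (pdS 1 (pdS 0 u)))

/-- On Schwartz functions the three orderings of the third derivative coincide, turning $\nu^2/3$
into $\nu^2$. Writing $l'\partial_{l'}u$ as $\partial_{l'}(l'u)-u$ puts the derivative outermost,
where the transform makes it a multiplication. -/
lemma adStarS_apply {ν : ℝ} (hν : ν ≠ 0) (X : sl2) (u : 𝓢(ℝ × ℝ, ℂ)) (x : ℝ × ℝ) :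
    adStarS ν X u x = adStar ν X u x := by
  have h1 : pd 0 (pd 1 (pd 1 u)) x = pdS 1 (pdS 1 (pdS 0 u)) x := by
    rw [← pdS_comm u 0 1, ← pdS_comm (pdS 1 u) 0 1]
    rfl
  have h2 : pd 1 (pd 0 (pd 1 u)) x = pdS 1 (pdS 1 (pdS 0 u)) x := by
    rw [← pdS_comm u 0 1]
    rfl
  have h3 : pd 1 (pd 1 (pd 0 u)) x = pdS 1 (pdS 1 (pdS 0 u)) x := rfl
  have h4 (i : Fin 2) : pd i u x = pdS i u x := rfl
  rw [adStar_eq hν, h1, h2, h3, h4, h4, adStarS, pdS_one_mulSnd]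
  simp
  ring

/-- Evaluation at a fixed vector commutes with the Fourier transform, which reduces the
operator-valued transform to scalar ones. -/
lemma fourierSnd_fourierSndDeriv_apply (u : 𝓢(ℝ × ℝ, ℂ)) (x y : ℝ × ℝ) :
    fourierSnd (fourierSndDeriv u) x y =
      y.1 * fourierSnd (pdS 0 u) x - 2 * pi * Complex.I * y.2 * fourierSnd (mulSnd u) x := by
  have h1 : fourierSnd (fourierSndDeriv u) x y = fourierSndEquiv ((y.1 : ℂ) • pdS 0 u
      - (2 * pi * Complex.I * y.2) • mulSnd u) x := by
    have h2 := congrArg (fun w : 𝓢(ℝ, ℂ) => w x.2)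
      (SchwartzMap.fourier_evalCLM_eq ℝ (slice (fourierSndDeriv u) x.1) y)
    refine Eq.trans h2.symm ?_
    change (𝓕 (SchwartzMap.evalCLM ℝ ℝ ℂ y (slice (fourierSndDeriv u) x.1)) : 𝓢(ℝ, ℂ)) x.2
      = (𝓕 (slice ((y.1 : ℂ) • pdS 0 u - (2 * pi * Complex.I * y.2) • mulSnd u) x.1) : 𝓢(ℝ, ℂ)) x.2
    congr 2
    ext v
    change fourierSndDeriv u (x.1, v) y = (y.1 : ℂ) • pdS 0 u (x.1, v)
      - (2 * pi * Complex.I * y.2) • mulSnd u (x.1, v)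
    have h3 : ((y.1, 0) : ℝ × ℝ) = y.1 • ((1, 0) : ℝ × ℝ) := by simp
    rw [fourierSndDeriv_apply, h3, map_smul, pdS_apply]
    simp
    ring
  rw [h1, map_sub, map_smul, map_smul]
  rfl

lemma fourierSnd_adStarS (ν : ℝ) (X : sl2) (u : 𝓢(ℝ × ℝ, ℂ)) (x : ℝ × ℝ) :
    fourierSnd (adStarS ν X u) x =
      X.1 0 0 * (2 * (2 * pi * Complex.I * x.2 * fourierSnd (mulSnd u) x - fourierSnd u x)
        - 2 * (x.1 * fourierSnd (pdS 0 u) x))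
      - X.1 0 1 * fourierSnd (pdS 0 u) x
      + X.1 1 0 * (x.1 ^ 2 * fourierSnd (pdS 0 u) x - 2 * pi * Complex.I * x.2 * fourierSnd u x
        - 2 * (x.1 * (2 * pi * Complex.I * x.2 * fourierSnd (mulSnd u) x - fourierSnd u x))
        + (ν : ℂ) ^ 2 * ((2 * pi * Complex.I * x.2) ^ 2 * fourierSnd (pdS 0 u) x)) := by
  have hs (v w : 𝓢(ℝ × ℝ, ℂ)) : fourierSnd (v - w) x = fourierSnd v x - fourierSnd w x :=
    congrArg (fun f : 𝓢(ℝ × ℝ, ℂ) => f x) (map_sub fourierSndEquiv v w)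
  have ha (v w : 𝓢(ℝ × ℝ, ℂ)) : fourierSnd (v + w) x = fourierSnd v x + fourierSnd w x :=
    congrArg (fun f : 𝓢(ℝ × ℝ, ℂ) => f x) (map_add fourierSndEquiv v w)
  have hm (c : ℂ) (v : 𝓢(ℝ × ℝ, ℂ)) : fourierSnd (c • v) x = c * fourierSnd v x :=
    congrArg (fun f : 𝓢(ℝ × ℝ, ℂ) => f x) (map_smul fourierSndEquiv c v)
  simp only [adStarS, hs, ha, hm, fourierSnd_mulFst, fourierSnd_pdS_one, smul_eq_mul,
    Complex.real_smul]
  ring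

end Intertwiner

/-! ### Infinitesimal equivalence, and uniqueness of the integrated representation -/

section Integration

open scoped Topology
open Filter hiding pi
open Real (pi)

/-- The computational heart. Both sides are linear in the transforms of $u$, $\partial_lu$ and
$l'u$, and the coefficients are compared one by one. -/
lemma psDeriv_fourierSnd {ν : ℝ} (hν : ν ≠ 0) (ha : 2 * pi * ν ≠ 0) {ℓ : ℤ} (hℓ : (ℓ : ℝ) = ν⁻¹)
    (X : sl2) (u : 𝓢(ℝ × ℝ, ℂ)) (z : ℂ) :
    psDeriv ℓ X (fun z => planeWeight (2 * pi * ν) * fourierSnd u (planeEquiv ha z)) z =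
      planeWeight (2 * pi * ν) * fourierSnd (adStarS ν X u) (planeEquiv ha z) := by
  have hd : HasFDerivAt (fun z => planeWeight (2 * pi * ν) * fourierSnd u (planeEquiv ha z)) _ z :=
    ((hasFDerivAt_fourierSnd u (planeEquiv ha z)).comp z
      (planeEquiv ha).hasFDerivAt).const_mul (planeWeight (2 * pi * ν))
  obtain ⟨x, rfl⟩ := (planeEquiv ha).symm.surjective z
  have hre : ((planeEquiv ha).symm x).re = x.1 := by
    have := congrArg Prod.fst ((planeEquiv ha).apply_symm_apply x)
    rwa [planeEquiv_apply] at this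
  have him : ((planeEquiv ha).symm x).im = x.2 * (2 * pi * ν) := by
    have := congrArg Prod.snd ((planeEquiv ha).apply_symm_apply x)
    rw [planeEquiv_apply] at this
    exact (div_eq_iff ha).1 this
  -- Here $\ell\nu=1$ enters: it matches the phase part of the multiplier with the transform of the
  -- term $-\partial_{l'}u$.
  have hℓ' : (ℓ : ℂ) * (X.1 1 0 * ((planeEquiv ha).symm x).im) = X.1 1 0 * (2 * pi * x.2) := by
    have h : (ℓ : ℝ) * (X.1 1 0 * ((planeEquiv ha).symm x).im) = X.1 1 0 * (2 * pi * x.2) := by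
      rw [hℓ, him]
      field_simp
    exact_mod_cast congrArg Complex.ofReal h
  have h1 : (X.1 1 0 * (planeEquiv ha).symm x ^ 2 - 2 * X.1 0 0 * (planeEquiv ha).symm x
      - X.1 0 1 : ℂ).re
      = X.1 1 0 * (x.1 ^ 2 - (x.2 * (2 * pi * ν)) ^ 2) - 2 * X.1 0 0 * x.1 - X.1 0 1 := by
    simp [sq, hre, him]
  have h2 : (X.1 1 0 * (planeEquiv ha).symm x ^ 2 - 2 * X.1 0 0 * (planeEquiv ha).symm x
      - X.1 0 1 : ℂ).im / (2 * pi * ν) = 2 * x.2 * (X.1 1 0 * x.1 - X.1 0 0) := by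
    rw [div_eq_iff ha]
    simp [sq, hre, him]
    ring
  rw [psDeriv, hd.fderiv]
  simp only [_root_.smul_apply, ContinuousLinearMap.comp_apply, ContinuousLinearEquiv.coe_coe,
    ContinuousLinearEquiv.apply_symm_apply]
  rw [fourierSnd_fourierSndDeriv_apply, fourierSnd_adStarS, planeEquiv_apply, h1, h2, hre,
    mul_assoc Complex.I, hℓ']
  generalize planeWeight (2 * pi * ν) = w
  generalize fourierSnd (pdS 0 u) x = A
  generalize fourierSnd (mulSnd u) x = B
  generalize fourierSnd u x = U
  push_cast
  rw [smul_eq_mul]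
  -- The third-order Moyal term supplies $(2\pi i\nu\xi)^2$, which is the $-(\operatorname{Im}z)^2$
  -- in $\operatorname{Re}z^2$.
  linear_combination (-(4 * w * X.1 1 0 * pi ^ 2 * x.2 ^ 2 * ν ^ 2 * A)) * Complex.I_sq

lemma integratesAdStar_starRep {ν : ℝ} (hν : ν ≠ 0) (ha : 2 * pi * ν ≠ 0) {ℓ : ℤ}
    (hℓ : (ℓ : ℝ) = ν⁻¹) : IntegratesAdStar ν (starRep ℓ ha) := by
  intro X u
  refine ⟨adStarS ν X u, adStarS_apply hν X u, ?_⟩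
  have hf : Differentiable ℝ
      (fun z => planeWeight (2 * pi * ν) * fourierSnd u (planeEquiv ha z)) := fun z =>
    (((hasFDerivAt_fourierSnd u (planeEquiv ha z)).comp z
      (planeEquiv ha).hasFDerivAt).const_mul (planeWeight (2 * pi * ν))).differentiableAt
  have hk := funext (psDeriv_fourierSnd hν ha hℓ X u)
  have h := hasDerivAt_psRep ℓ X hf
    (by
      rw [hk]
      exact continuous_const.mul
        ((fourierSndS (adStarS ν X u)).continuous.comp (planeEquiv ha).continuous))
    (normFourier_toLp ha u) (by rw [hk]; exact normFourier_toLp ha (adStarS ν X u))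
  have h' := ((unitaryFourier ha).symm.toContinuousLinearEquiv :
    L2C →L[ℂ] L2Plane).restrictScalars ℝ |>.hasFDerivAt.comp_hasDerivAt (0 : ℝ) h
  refine h'.congr_deriv ?_
  exact (unitaryFourier ha).symm_apply_apply _

/-- Two representations that integrate `ad_⋆` agree on vectors whose orbit under the first one
consists of Schwartz functions. -/
lemma IntegratesAdStar.apply_eq {ν : ℝ} {π π' : SL(2, ℝ) →* (L2Plane ≃ₗᵢ[ℂ] L2Plane)}
    (hπ : IntegratesAdStar ν π) (hπ' : IntegratesAdStar ν π') (X : sl2) {u : L2Plane}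
    (hu : ∀ s : ℝ, ∃ y : 𝓢(ℝ × ℝ, ℂ), π (expSL (s • X)) u = y.toLp 2 volume) (t : ℝ) :
    π' (expSL (t • X)) u = π (expSL (t • X)) u := by
  have hm (ρ : SL(2, ℝ) →* (L2Plane ≃ₗᵢ[ℂ] L2Plane)) (g h : SL(2, ℝ)) (v : L2Plane) :
      ρ (g * h) v = ρ g (ρ h v) := by
    rw [map_mul]
    rfl
  have hexp0 : expSL 0 = 1 := zero_smul ℝ X ▸ expSL_zero_smul X
  set w : ℝ → L2Plane := fun s => π' (expSL (s • X))⁻¹ (π (expSL (s • X)) u) with hw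
  have hd (s : ℝ) : HasDerivAt w 0 s := by
    obtain ⟨y, hy⟩ := hu s
    obtain ⟨v, hv, h⟩ := hπ X y
    obtain ⟨v', hv', h'⟩ := hπ' X y
    obtain rfl : v = v' := by
      ext x
      rw [hv, hv']
    have h0 := h.sub h'
    rw [← sub_self s, sub_self (v.toLp 2 volume)] at h0
    have h1 := h0.comp_sub_const s s
    -- Applying the isometry $\pi'(\exp rX)$ compares two curves that start at the same Schwartz
    -- vector `y` with the same velocity.
    have key (r : ℝ) : ‖w r - w s‖ = ‖π (expSL ((r - s) • X)) (y.toLp 2 volume)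
        - π' (expSL ((r - s) • X)) (y.toLp 2 volume)‖ := by
      have e : expSL (r • X) = expSL ((r - s) • X) * expSL (s • X) := by
        rw [← expSL_add_smul, sub_add_cancel]
      rw [← (π' (expSL (r • X))).norm_map, map_sub, ← hy]
      simp only [hw]
      rw [← hm, ← hm, mul_inv_cancel, e, mul_inv_cancel_right, map_one, hm π]
      rfl
    rw [hasDerivAt_iff_isLittleO] at h1 ⊢
    refine h1.norm_left.congr' (Eventually.of_forall fun r => ?_) EventuallyEq.rfl |>.of_norm_left
    have := key r
    simp only [smul_zero, sub_zero, this]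
    simp [hexp0]
  have hc := is_const_of_deriv_eq_zero (fun s => (hd s).differentiableAt)
    (fun s => (hd s).deriv) t 0
  simp only [hw, expSL_zero_smul] at hc
  calc π' (expSL (t • X)) u = π' (expSL (t • X)) (π' (expSL (t • X))⁻¹ (π (expSL (t • X)) u)) := by
        rw [hc]; simp
    _ = π (expSL (t • X)) u := by
        rw [← hm, mul_inv_cancel, map_one]; rfl

/-- Vectors whose transform lies in the core stay Schwartz along the orbits of `starRep`, so
`IntegratesAdStar.apply_eq` applies to them. Density extends the equality to all vectors, and
generation by unipotents to the whole group. -/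
lemma eq_starRep_of_integratesAdStar {ν : ℝ} (hν : ν ≠ 0) (ha : 2 * pi * ν ≠ 0) {ℓ : ℤ}
    (hℓ : (ℓ : ℝ) = ν⁻¹) {π' : SL(2, ℝ) →* (L2Plane ≃ₗᵢ[ℂ] L2Plane)}
    (hπ' : IntegratesAdStar ν π') : π' = starRep ℓ ha := by
  have hd : Dense (unitaryFourier ha ⁻¹' (coreL2 : Set L2C)) :=
    dense_coreL2.preimage (unitaryFourier ha).toHomeomorph.isOpenMap
  have hexp (X : sl2) (t : ℝ) : expSL (t • X) ∈ π'.eqLocus (starRep ℓ ha) := by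
    refine LinearIsometryEquiv.ext fun u => ?_
    refine congrFun ((π' (expSL (t • X))).continuous.ext_on hd
      (starRep ℓ ha (expSL (t • X))).continuous fun u hu => ?_) u
    obtain ⟨f, hf, hfu⟩ := hu
    refine (integratesAdStar_starRep hν ha hℓ).apply_eq hπ' X (fun s => ?_) t
    obtain ⟨y, hy⟩ := exists_normFourier_eq ha (F := psRep ℓ (inclSL (expSL (s • X)))
      (unitaryFourier ha u)) ⟨_, hf.principalSeries ℓ _, coeFn_psRep ℓ _ hfu⟩
    refine ⟨y, ?_⟩
    rw [starRep_apply, ← hy]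
    exact (unitaryFourier ha).symm_apply_apply _
  have htop := sl2_generators (K := π'.eqLocus (starRep ℓ ha)) (hexp E) (hexp F)
  exact MonoidHom.ext fun g => by
    have hg : g ∈ π'.eqLocus (starRep ℓ ha) := htop ▸ Subgroup.mem_top g
    exact hg

end Integration

end StarRep

end

open StarRep in
theorem theorem4p2 (ν : ℝ) (hν : ν ≠ 0) (ℓ : ℤ) (hℓ : (ℓ : ℝ) = ν⁻¹) :
    ∃ (π : SL(2, ℝ) →* (L2Plane ≃ₗᵢ[ℂ] L2Plane)) (P : SL(2, ℂ) →* (L2C ≃ₗᵢ[ℂ] L2C))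
      (T : L2Plane ≃L[ℂ] L2C),
      -- the star representation exponentiates to the group, in exactly one way
      (StronglyContinuous π ∧ IntegratesAdStar ν π ∧
        ∀ π' : SL(2, ℝ) →* (L2Plane ≃ₗᵢ[ℂ] L2Plane),
          StronglyContinuous π' → IntegratesAdStar ν π' → π' = π) ∧
      -- it is equivalent, by the partial Fourier transform, to the restricted principal series
      (StronglyContinuous P ∧ IsPrincipalSeries (-2) ℓ P) ∧
      IsPartialFourier ν T ∧
      ∀ (g : SL(2, ℝ)) (u : L2Plane), T (π g u) = P (inclSL g) (T u) := by
  have ha : 2 * Real.pi * ν ≠ 0 := mul_ne_zero (by positivity) hν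
  exact ⟨starRep ℓ ha, psRep ℓ, fourierIso ha,
    ⟨stronglyContinuous_starRep ℓ ha, integratesAdStar_starRep hν ha hℓ,
      fun _ _ h => eq_starRep_of_integratesAdStar hν ha hℓ h⟩,
    ⟨stronglyContinuous_psRep ℓ, isPrincipalSeries_psRep ℓ⟩,
    isPartialFourier_fourierIso ha, fourierIso_starRep ℓ ha⟩
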